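/- Let $d\ge 1$ and $0<s<d$. For a function $\rho\ge 0$ on $\mathbb R^d$ with $\int_{\mathbb R^d}\rho=N\in\mathbb N$, the indirect energy is $$E(\rho)=\inf_{\mathbb P}\int_{\mathbb R^{dN}}\sum_{1\le j<k\le N}\frac{1}{|x_j-x_k|^s}\,d\mathbb P(x_1,\dots,x_N)-\frac12\int_{\mathbb R^d}\int_{\mathbb R^d}\frac{\rho(x)\rho(y)}{|x-y|^s}\,dx\,dy,$$ where the infimum is over all Borel probability measures $\mathbb P$ on $(\mathbb R^d)^N$ whose $N$ one-particle marginals add up to $\rho(x)\,dx$. Write $E(\Omega)=E(\mathbf 1_\Omega)$ for a set $\Omega$ whose volume $|\Omega|$ is an integer. Let $e_{\rm UEG}$ be the energy of the classical uniform electron gas at density one, that is, the number such that $$\lim_{n\to\infty}\frac{E(\Omega_n)}{|\Omega_n|}=e_{\rm UEG}$$ for every sequence $(\Omega_n)$ of bounded connected open subsets of $\mathbb R^d$ of integer volume with $|\Omega_n|\to\infty$ for which there are $t_0>0$ and a continuous function $\eta:[0,t_0)\to[0,\infty)$ with $\eta(0)=0$ such that $$\big|\{x:\ {\rm d}(x,\partial\Omega_n)\le|\Omega_n|^{1/d}\,t\}\big|\le|\Omega_n|\,\eta(t)\qquad\text{for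 all }0\le t<t_0\text{ and all }n.$$ This real number $e_{\rm UEG}$ exists (it depends only on $d$ and $s$). **Theorem 2.7 (Bound for specific sets).** Let $\Omega\subset\mathbb R^d$ be a parallelepiped, or any other convex polyhedron (for instance a tetrahedron) that generates a tiling of $\mathbb R^d$, meaning that $\mathbb R^d$ is covered by a family of congruent copies of $\Omega$ with pairwise disjoint interiors. (Polyhedra are closed, bounded and have non-empty interior.) Assume that $|\Omega|$ is an integer. Then $$\frac{E(\Omega)}{|\Omega|}\ge e_{\rm UEG}.$$ -/

import Mathlib

open MeasureTheory Filter Topology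
open scoped ENNReal

namespace UEG

/-- The Riesz interaction `1 / |x - y| ^ s`, with value `∞` on the diagonal (for `s > 0`). -/
noncomputable def riesz {d : ℕ} (s : ℝ) (x y : EuclideanSpace ℝ (Fin d)) : ℝ≥0∞ :=
  edist x y ^ (-s)

/-- The density `ρ_P` of an `N`-particle probability `P`, as a measure on `ℝ^d`: the sum of the
`N` one-particle marginals of `P`. -/
noncomputable def density {d N : ℕ} (P : Measure (Fin N → EuclideanSpace ℝ (Fin d))) :
    Measure (EuclideanSpace ℝ (Fin d)) :=
  ∑ j : Fin N, P.map (fun x => x j)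

/-- The many-particle energy `C(P) = ∫ ∑_{j < k} 1 / |x_j - x_k| ^ s dP(x_1, …, x_N)`. -/
noncomputable def pairEnergy {d N : ℕ} (s : ℝ)
    (P : Measure (Fin N → EuclideanSpace ℝ (Fin d))) : ℝ≥0∞ :=
  ∫⁻ x, ∑ j : Fin N, ∑ k ∈ Finset.Ioi j, riesz s (x j) (x k) ∂P

/-- The direct energy `D(ρ, ρ) = (1/2) ∫∫ ρ(x) ρ(y) / |x - y| ^ s dx dy`. -/
noncomputable def directEnergy {d : ℕ} (s : ℝ) (ρ : EuclideanSpace ℝ (Fin d) → ℝ≥0∞) : ℝ≥0∞ :=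
  2⁻¹ * ∫⁻ x, ∫⁻ y, ρ x * ρ y * riesz s x y

/-- The infimum of `C(P)` over all `N`-particle probabilities `P` with `ρ_P = ρ`. The constraint
forces `N = ∫ ρ`. -/
noncomputable def minPairEnergy {d : ℕ} (s : ℝ) (ρ : EuclideanSpace ℝ (Fin d) → ℝ≥0∞) : ℝ≥0∞ :=
  ⨅ (N : ℕ) (P : Measure (Fin N → EuclideanSpace ℝ (Fin d))) (_ : IsProbabilityMeasure P)
    (_ : density P = volume.withDensity ρ), pairEnergy s P

/-- The indirect energy `E(ρ)`. Both terms are finite for the densities used below, which are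
indicators of bounded sets whose volume is a positive integer. -/
noncomputable def indirectEnergy {d : ℕ} (s : ℝ) (ρ : EuclideanSpace ℝ (Fin d) → ℝ≥0∞) : ℝ :=
  (minPairEnergy s ρ).toReal - (directEnergy s ρ).toReal

/-- The shorthand `E(Ω) = E(1_Ω)`. -/
noncomputable def setEnergy {d : ℕ} (s : ℝ) (Ω : Set (EuclideanSpace ℝ (Fin d))) : ℝ :=
  indirectEnergy s (Ω.indicator 1)

/-- `Ω` has an `η`-regular boundary (in the sense of Fisher) on `[0, t₀)`:
`|{x : d(x, ∂Ω) ≤ |Ω|^{1/d} t}| ≤ |Ω| η(t)`. -/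
def HasRegularBoundary {d : ℕ} (t₀ : ℝ) (η : ℝ → ℝ) (Ω : Set (EuclideanSpace ℝ (Fin d))) : Prop :=
  ∀ t ∈ Set.Ico 0 t₀,
    volume {x | Metric.infDist x (frontier Ω) ≤ volume.real Ω ^ (1 / (d : ℝ)) * t} ≤
      ENNReal.ofReal (volume.real Ω * η t)

/-- The sequences along which the thermodynamic limit is taken: bounded connected open sets
of integer volume, with `|Ω_n| → ∞`, all having an `η`-regular boundary with one common `η`. -/
structure IsThermodynamicSequence {d : ℕ} (Ω : ℕ → Set (EuclideanSpace ℝ (Fin d))) : Prop where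
  isOpen : ∀ n, IsOpen (Ω n)
  isConnected : ∀ n, IsConnected (Ω n)
  isBounded : ∀ n, Bornology.IsBounded (Ω n)
  volume_integer : ∀ n, ∃ N : ℕ, volume (Ω n) = N
  volume_tendsto : Tendsto (fun n => volume.real (Ω n)) atTop atTop
  regular : ∃ t₀ > 0, ∃ η : ℝ → ℝ, ContinuousOn η (Set.Ico 0 t₀) ∧ (∀ t ∈ Set.Ico 0 t₀, 0 ≤ η t) ∧
    η 0 = 0 ∧ ∀ n, HasRegularBoundary t₀ η (Ω n)

/-- `e` is the thermodynamic limit of the energy per unit volume at density one, along every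
admissible sequence of domains. At most one `e` has this property (take for `Ω_n` balls). -/
def IsThermodynamicLimit (d : ℕ) (s e : ℝ) : Prop :=
  ∀ Ω : ℕ → Set (EuclideanSpace ℝ (Fin d)), IsThermodynamicSequence Ω →
    Tendsto (fun n => setEnergy s (Ω n) / volume.real (Ω n)) atTop (𝓝 e)

/-- The energy `e_UEG` of the classical uniform electron gas: the number that is the thermodynamic
limit along all admissible sequences. (That there is such a number is not part of this definition;
it has to be proved.) -/
noncomputable def eUEG (d : ℕ) (s : ℝ) : ℝ :=
  Classical.epsilon (IsThermodynamicLimit d s)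

/-- A (closed, bounded, full-dimensional) parallelepiped with a vertex `a` and edges `v`. -/
def IsParallelepiped {d : ℕ} (Ω : Set (EuclideanSpace ℝ (Fin d))) : Prop :=
  ∃ (a : EuclideanSpace ℝ (Fin d)) (v : Fin d → EuclideanSpace ℝ (Fin d)),
    LinearIndependent ℝ v ∧ Ω = (fun x => a + x) '' parallelepiped v

/-- A (closed, bounded, full-dimensional) convex polyhedron. -/
def IsConvexPolyhedron {d : ℕ} (Ω : Set (EuclideanSpace ℝ (Fin d))) : Prop :=
  (∃ S : Finset (EuclideanSpace ℝ (Fin d)), Ω = convexHull ℝ (S : Set (EuclideanSpace ℝ (Fin d)))) ∧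
    (interior Ω).Nonempty

/-- The closed set `Ω` generates a tiling of `ℝ^d`: the space is covered by congruent copies `g Ω`
whose interiors are pairwise disjoint. The set `G` of isometries may in particular be a discrete
group of translations and rotations. -/
def GeneratesTiling {d : ℕ} (Ω : Set (EuclideanSpace ℝ (Fin d))) : Prop :=
  ∃ G : Set (EuclideanSpace ℝ (Fin d) ≃ᵃⁱ[ℝ] EuclideanSpace ℝ (Fin d)),
    (⋃ g ∈ G, g '' Ω) = Set.univ ∧ G.PairwiseDisjoint (fun g => g '' interior Ω)

end UEG

namespace UEG

/-! The argument rests on three properties of `setEnergy` on sets of integer volume. It is invariant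
under isometries. It is nonpositive, because independent particles cost no more than the direct
energy (`setEnergy_nonpos`). It is subadditive on disjoint sets (`setEnergy_union_le`): for a tensor
product of two plans the pair energy grows by exactly the interaction of the two densities, which is
also the cross term of the direct energy, so the two cancel.

Hence disjoint tiles inside a set `A` bound its energy from above by the number of tiles times the
energy of one tile; the uncovered part again has integer volume and can only lower the energy
(`setEnergy_le_of_tiles`). Filling large balls with copies of a tile `Ω` leaves a relatively
negligible shell, so the limit along balls is at most `E(Ω)/|Ω|`. Parallelepipeds tile by lattice
translations.

The limit is the infimum of the energy per volume over cubes of integer side. The upper bound along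
a sequence comes from filling the domain with cubes of fixed side. For the lower bound the domain is
enclosed in a large cube of comparable volume, and the rest of that cube is filled with small cubes:
the large cube has energy at least the infimum times its volume, so the domain cannot have much less
than its share. Comparability of the volumes uses connectedness and boundary regularity
(`exists_dist_lt_of_hasRegularBoundary`).

The infimum is finite by a Lieb-Oxford-type bound (`exists_direct_le_minPairEnergyOf`). The Riesz
kernel is split into Gaussians `exp (-t |x - y|²)` with `t ≤ 1` and `t > 1`. The first part is
positive definite and bounded on the diagonal since `s > 0`; the second has finite integral over
space since `s < d`. Each costs at most a constant per unit volume. -/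

/-! ### Energies of measures -/

lemma measurable_riesz {d : ℕ} (s : ℝ) :
    Measurable (fun p : EuclideanSpace ℝ (Fin d) × EuclideanSpace ℝ (Fin d) =>
      riesz s p.1 p.2) := by
  unfold riesz
  fun_prop

lemma riesz_comm {d : ℕ} (s : ℝ) (x y : EuclideanSpace ℝ (Fin d)) : riesz s x y = riesz s y x := by
  rw [riesz, riesz, edist_comm]

/-- The infimum of the pair energy over all probabilities whose density is the measure `μ`. -/
noncomputable def minPairEnergyOf {d : ℕ} (s : ℝ) (μ : Measure (EuclideanSpace ℝ (Fin d))) :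
    ℝ≥0∞ :=
  ⨅ (N : ℕ) (P : Measure (Fin N → EuclideanSpace ℝ (Fin d))) (_ : IsProbabilityMeasure P)
    (_ : density P = μ), pairEnergy s P

/-- The interaction energy of two measures. -/
noncomputable def interEnergy {d : ℕ} (s : ℝ) (μ ν : Measure (EuclideanSpace ℝ (Fin d))) :
    ℝ≥0∞ :=
  ∫⁻ x, ∫⁻ y, riesz s x y ∂ν ∂μ

lemma minPairEnergyOf_le {d N : ℕ} {s : ℝ} (P : Measure (Fin N → EuclideanSpace ℝ (Fin d)))
    [hP : IsProbabilityMeasure P] : minPairEnergyOf s (density P) ≤ pairEnergy s P :=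
  iInf_le_of_le N <| iInf_le_of_le P <| iInf_le_of_le hP <| iInf_le_of_le rfl le_rfl

lemma le_minPairEnergyOf {d : ℕ} {s : ℝ} {μ : Measure (EuclideanSpace ℝ (Fin d))} {c : ℝ≥0∞}
    (h : ∀ (N : ℕ) (P : Measure (Fin N → EuclideanSpace ℝ (Fin d))), IsProbabilityMeasure P →
      density P = μ → c ≤ pairEnergy s P) : c ≤ minPairEnergyOf s μ :=
  le_iInf fun N => le_iInf fun P => le_iInf fun hP => le_iInf fun h' => h N P hP h'

lemma minPairEnergy_indicator {d : ℕ} (s : ℝ) {A : Set (EuclideanSpace ℝ (Fin d))}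
    (hA : MeasurableSet A) :
    minPairEnergy s (A.indicator 1) = minPairEnergyOf s (volume.restrict A) := by
  rw [minPairEnergy, minPairEnergyOf, withDensity_indicator_one hA]

lemma directEnergy_indicator {d : ℕ} (s : ℝ) {A : Set (EuclideanSpace ℝ (Fin d))}
    (hA : MeasurableSet A) :
    directEnergy s (A.indicator 1) =
      2⁻¹ * interEnergy s (volume.restrict A) (volume.restrict A) := by
  rw [directEnergy, interEnergy, ← lintegral_indicator hA]
  congr 1
  refine lintegral_congr fun x => ?_
  by_cases hx : x ∈ A
  · rw [Set.indicator_of_mem hx, Set.indicator_of_mem hx, ← lintegral_indicator hA]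
    refine lintegral_congr fun y => ?_
    by_cases hy : y ∈ A <;> simp [hy]
  · simp [hx]

section InterEnergy

variable {d : ℕ} {s : ℝ} (μ μ' ν : Measure (EuclideanSpace ℝ (Fin d)))

lemma interEnergy_comm [SFinite μ] [SFinite ν] : interEnergy s μ ν = interEnergy s ν μ := by
  rw [interEnergy, lintegral_lintegral_swap (measurable_riesz s).aemeasurable, interEnergy]
  simp_rw [riesz_comm]

lemma interEnergy_add_left : interEnergy s (μ + μ') ν = interEnergy s μ ν + interEnergy s μ' ν := by
  rw [interEnergy, lintegral_add_measure, interEnergy, interEnergy]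

lemma interEnergy_add_right [SFinite μ] [SFinite μ'] [SFinite ν] :
    interEnergy s ν (μ + μ') = interEnergy s ν μ + interEnergy s ν μ' := by
  rw [interEnergy_comm, interEnergy_add_left, interEnergy_comm μ, interEnergy_comm μ']

/-- Polarisation. The cross term has coefficient one, the same as in the pair energy of two
independent systems; this is what makes the indirect energy subadditive. -/
lemma interEnergy_add_self [SFinite μ] [SFinite ν] :
    2⁻¹ * interEnergy s (μ + ν) (μ + ν) =
      2⁻¹ * interEnergy s μ μ + 2⁻¹ * interEnergy s ν ν + interEnergy s μ ν := by
  rw [interEnergy_add_left, interEnergy_add_right, interEnergy_add_right, interEnergy_comm ν μ]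
  calc _ = 2⁻¹ * interEnergy s μ μ + 2⁻¹ * interEnergy s ν ν
        + 2⁻¹ * 2 * interEnergy s μ ν := by ring
    _ = _ := by rw [ENNReal.inv_mul_cancel (by simp) (by simp), one_mul]

end InterEnergy

/-! ### Independent systems and subadditivity -/

lemma measurable_append {d N M : ℕ} :
    Measurable (fun p : (Fin N → EuclideanSpace ℝ (Fin d)) ×
      (Fin M → EuclideanSpace ℝ (Fin d)) => Fin.append p.1 p.2) := by
  rw [measurable_pi_iff]
  intro i
  refine Fin.addCases (fun j => ?_) (fun j => ?_) i
  · simp only [Fin.append_left]; fun_prop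
  · simp only [Fin.append_right]; fun_prop

lemma density_map_append {d N M : ℕ} (P : Measure (Fin N → EuclideanSpace ℝ (Fin d)))
    (Q : Measure (Fin M → EuclideanSpace ℝ (Fin d))) [IsProbabilityMeasure P]
    [IsProbabilityMeasure Q] :
    density ((P.prod Q).map (fun p => Fin.append p.1 p.2)) = density P + density Q := by
  have hm := measurable_append (d := d) (N := N) (M := M)
  rw [density, Fin.sum_univ_add, density, density]
  congr 1
  · refine Finset.sum_congr rfl fun j _ => ?_
    rw [Measure.map_map (by fun_prop) hm]
    have : ((fun x : Fin (N + M) → EuclideanSpace ℝ (Fin d) => x (Fin.castAdd M j)) ∘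
        fun p : (Fin N → EuclideanSpace ℝ (Fin d)) × (Fin M → EuclideanSpace ℝ (Fin d)) =>
          Fin.append p.1 p.2) = (fun x => x j) ∘ Prod.fst := by
      ext1 p; simp
    rw [this, ← Measure.map_map (by fun_prop) (by fun_prop)]
    simp
  · refine Finset.sum_congr rfl fun j _ => ?_
    rw [Measure.map_map (by fun_prop) hm]
    have : ((fun x : Fin (N + M) → EuclideanSpace ℝ (Fin d) => x (Fin.natAdd N j)) ∘
        fun p : (Fin N → EuclideanSpace ℝ (Fin d)) × (Fin M → EuclideanSpace ℝ (Fin d)) =>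
          Fin.append p.1 p.2) = (fun x => x j) ∘ Prod.snd := by
      ext1 p; simp
    rw [this, ← Measure.map_map (by fun_prop) (by fun_prop)]
    simp

lemma lintegral_density {d N : ℕ} (P : Measure (Fin N → EuclideanSpace ℝ (Fin d)))
    {f : EuclideanSpace ℝ (Fin d) → ℝ≥0∞} (hf : Measurable f) :
    ∫⁻ x, f x ∂(density P) = ∫⁻ x, ∑ j, f (x j) ∂P := by
  rw [density, lintegral_finsetSum_measure, lintegral_finsetSum _ (fun j _ => by fun_prop)]
  exact Finset.sum_congr rfl fun j _ => lintegral_map hf (by fun_prop)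

lemma sum_pair_eq_sum_ite {α : Type*} {N : ℕ} (w : α → α → ℝ≥0∞) (x : Fin N → α) :
    ∑ j : Fin N, ∑ k ∈ Finset.Ioi j, w (x j) (x k) =
      ∑ j : Fin N, ∑ k : Fin N, if j < k then w (x j) (x k) else 0 := by
  refine Finset.sum_congr rfl fun j _ => ?_
  rw [← Finset.sum_filter]
  refine Finset.sum_congr ?_ fun _ _ => rfl
  ext k; simp

lemma sum_pair_append {α : Type*} {N M : ℕ} (w : α → α → ℝ≥0∞) (x : Fin N → α) (y : Fin M → α) :
    ∑ j, ∑ k ∈ Finset.Ioi j, w (Fin.append x y j) (Fin.append x y k) =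
      (∑ j, ∑ k ∈ Finset.Ioi j, w (x j) (x k)) + (∑ j, ∑ k ∈ Finset.Ioi j, w (y j) (y k)) +
        ∑ j, ∑ k, w (x j) (y k) := by
  simp_rw [sum_pair_eq_sum_ite, Fin.sum_univ_add, Fin.append_left, Fin.append_right]
  have h1 (i : Fin N) (j : Fin M) : Fin.castAdd M i < Fin.natAdd N j := by
    rw [Fin.lt_def]; simp; omega
  have h2 (i : Fin N) (j : Fin M) : ¬ Fin.natAdd N j < Fin.castAdd M i := (h1 i j).asymm
  have h3 (i j : Fin N) : Fin.castAdd M i < Fin.castAdd M j ↔ i < j := Iff.rfl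
  have h4 (i j : Fin M) : Fin.natAdd N i < Fin.natAdd N j ↔ i < j := by
    rw [Fin.lt_def, Fin.lt_def]; simp
  simp only [h1, h2, h3, h4, if_true, if_false, Finset.sum_add_distrib, Finset.sum_const_zero]
  ring

lemma measurable_riesz_comp {d : ℕ} (s : ℝ) {α : Type*} [MeasurableSpace α]
    {f g : α → EuclideanSpace ℝ (Fin d)} (hf : Measurable f) (hg : Measurable g) :
    Measurable (fun a => riesz s (f a) (g a)) := by
  unfold riesz
  exact (hf.edist hg).pow_const _

lemma measurable_sum_pair {d N : ℕ} (s : ℝ) :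
    Measurable (fun x : Fin N → EuclideanSpace ℝ (Fin d) =>
      ∑ j : Fin N, ∑ k ∈ Finset.Ioi j, riesz s (x j) (x k)) := by
  refine Finset.measurable_fun_sum _ fun j _ => Finset.measurable_fun_sum _ fun k _ => ?_
  exact measurable_riesz_comp s (measurable_pi_apply j) (measurable_pi_apply k)

/-- Pairs lie within the first group, within the second, or across. By independence the cross pairs
see only the two one-particle densities, so their energy does not depend on the correlations inside
`P` and `Q`. -/
lemma pairEnergy_map_append {d N M : ℕ} (s : ℝ) (P : Measure (Fin N → EuclideanSpace ℝ (Fin d)))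
    (Q : Measure (Fin M → EuclideanSpace ℝ (Fin d))) [IsProbabilityMeasure P]
    [IsProbabilityMeasure Q] :
    pairEnergy s ((P.prod Q).map (fun p => Fin.append p.1 p.2)) =
      pairEnergy s P + pairEnergy s Q + interEnergy s (density P) (density Q) := by
  have hm := measurable_append (d := d) (N := N) (M := M)
  have hX : Measurable (fun p : (Fin N → EuclideanSpace ℝ (Fin d)) ×
      (Fin M → EuclideanSpace ℝ (Fin d)) => ∑ j, ∑ k ∈ Finset.Ioi j, riesz s (p.1 j) (p.1 k)) :=
    (measurable_sum_pair s).comp measurable_fst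
  have hY : Measurable (fun p : (Fin N → EuclideanSpace ℝ (Fin d)) ×
      (Fin M → EuclideanSpace ℝ (Fin d)) => ∑ j, ∑ k ∈ Finset.Ioi j, riesz s (p.2 j) (p.2 k)) :=
    (measurable_sum_pair s).comp measurable_snd
  have hXY : Measurable (fun p : (Fin N → EuclideanSpace ℝ (Fin d)) ×
      (Fin M → EuclideanSpace ℝ (Fin d)) => ∑ j, ∑ k, riesz s (p.1 j) (p.2 k)) := by
    refine Finset.measurable_fun_sum _ fun j _ => Finset.measurable_fun_sum _ fun k _ => ?_
    exact measurable_riesz_comp s (by fun_prop) (by fun_prop)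
  rw [pairEnergy, lintegral_map (measurable_sum_pair s) hm]
  simp_rw [sum_pair_append]
  rw [lintegral_add_right _ hXY, lintegral_add_left hX,
    lintegral_prod _ hX.aemeasurable, lintegral_prod _ hY.aemeasurable,
    lintegral_prod _ hXY.aemeasurable]
  have hint : Measurable fun x => ∫⁻ y, riesz s x y ∂(density Q) := by
    have : SFinite (density Q) := by
      unfold density
      infer_instance
    exact (measurable_riesz s).lintegral_prod_right'
  congr 1
  · simp [pairEnergy]
  · rw [interEnergy, lintegral_density P hint]
    refine lintegral_congr fun x => ?_
    rw [lintegral_finsetSum _ (fun j _ => Finset.measurable_fun_sum _ fun k _ =>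
      measurable_riesz_comp s measurable_const (measurable_pi_apply k))]
    refine Finset.sum_congr rfl fun j _ => ?_
    exact (lintegral_density Q (f := fun y => riesz s (x j) y)
      (measurable_riesz_comp s measurable_const measurable_id)).symm

/-- Subadditivity, by taking tensor products. -/
theorem minPairEnergyOf_add_le {d : ℕ} (s : ℝ) (μ ν : Measure (EuclideanSpace ℝ (Fin d))) :
    minPairEnergyOf s (μ + ν) ≤
      minPairEnergyOf s μ + minPairEnergyOf s ν + interEnergy s μ ν := by
  have key : ∀ (N : ℕ) (P : Measure (Fin N → EuclideanSpace ℝ (Fin d))), IsProbabilityMeasure P →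
      density P = μ → ∀ (M : ℕ) (Q : Measure (Fin M → EuclideanSpace ℝ (Fin d))),
      IsProbabilityMeasure Q → density Q = ν →
      minPairEnergyOf s (μ + ν) ≤ pairEnergy s P + pairEnergy s Q + interEnergy s μ ν := by
    rintro N P hP rfl M Q hQ rfl
    have hm := measurable_append (d := d) (N := N) (M := M)
    have := Measure.isProbabilityMeasure_map (μ := P.prod Q) hm.aemeasurable
    rw [← density_map_append, ← pairEnergy_map_append]
    exact minPairEnergyOf_le _
  simp only [minPairEnergyOf, ENNReal.iInf_add, ENNReal.add_iInf]
  exact le_iInf fun N => le_iInf fun P => le_iInf fun hP => le_iInf fun h => le_iInf fun M =>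
    le_iInf fun Q => le_iInf fun hQ => le_iInf fun h' => key M Q hQ h' N P hP h

lemma minPairEnergyOf_zero {d : ℕ} (s : ℝ) :
    minPairEnergyOf s (0 : Measure (EuclideanSpace ℝ (Fin d))) = 0 := by
  have := minPairEnergyOf_le (s := s)
    (Measure.dirac (default : Fin 0 → EuclideanSpace ℝ (Fin d)))
  simpa [density, pairEnergy] using this

lemma minPairEnergyOf_prob {d : ℕ} (s : ℝ) (μ : Measure (EuclideanSpace ℝ (Fin d)))
    [IsProbabilityMeasure μ] : minPairEnergyOf s μ = 0 := by
  have hm : Measurable (fun (x : EuclideanSpace ℝ (Fin d)) (_ : Fin 1) => x) := by fun_prop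
  have hp := Measure.isProbabilityMeasure_map (μ := μ) hm.aemeasurable
  have h := minPairEnergyOf_le (s := s) (μ.map (fun x (_ : Fin 1) => x))
  have h1 : density (μ.map (fun x (_ : Fin 1) => x)) = μ := by
    rw [density, Fin.sum_univ_one, Measure.map_map (by fun_prop) hm]
    exact Measure.map_id
  have h2 : pairEnergy s (μ.map (fun x (_ : Fin 1) => x)) = 0 := by
    simp [pairEnergy]
  rw [h1, h2] at h
  exact le_antisymm h zero_le

/-- Independent particles have at most the direct energy. -/
theorem minPairEnergyOf_le_direct {d : ℕ} (s : ℝ) (μ : Measure (EuclideanSpace ℝ (Fin d)))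
    {N : ℕ} (hN : μ Set.univ = N) : minPairEnergyOf s μ ≤ 2⁻¹ * interEnergy s μ μ := by
  rcases Nat.eq_zero_or_pos N with rfl | hpos
  · have : μ = 0 := by simpa using hN
    simp [this, minPairEnergyOf_zero]
  have hN0 : (N : ℝ≥0∞) ≠ 0 := by exact_mod_cast hpos.ne'
  -- The plan is `N` independent particles with law `ν`, added one at a time. A single particle has
  -- no pair energy, so each step gains only the interaction with the earlier particles.
  set ν : Measure (EuclideanSpace ℝ (Fin d)) := (N : ℝ≥0∞)⁻¹ • μ with hν
  have hνp : IsProbabilityMeasure ν := ⟨by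
    simp [hν, hN, ENNReal.inv_mul_cancel hN0 (ENNReal.natCast_ne_top N)]⟩
  have hμ : μ = (N : ℕ) • ν := by
    rw [hν, ← Nat.cast_smul_eq_nsmul ℝ≥0∞, smul_smul,
      ENNReal.mul_inv_cancel hN0 (ENNReal.natCast_ne_top N), one_smul]
  have key : ∀ k : ℕ, minPairEnergyOf s (k • ν) ≤ 2⁻¹ * interEnergy s (k • ν) (k • ν) := by
    intro k
    induction k with
    | zero => simp [minPairEnergyOf_zero]
    | succ k ih =>
      have : SFinite (k • ν) := by
        rw [← Nat.cast_smul_eq_nsmul ℝ≥0∞]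
        infer_instance
      rw [succ_nsmul, interEnergy_add_self]
      refine (minPairEnergyOf_add_le s _ _).trans ?_
      gcongr
      rw [minPairEnergyOf_prob]
      exact zero_le
  rw [hμ]
  exact key N

/-! ### Invariance under isometries -/

section Isometry

variable {d : ℕ} {s : ℝ} (g : EuclideanSpace ℝ (Fin d) ≃ᵃⁱ[ℝ] EuclideanSpace ℝ (Fin d))

lemma riesz_isometry (x y : EuclideanSpace ℝ (Fin d)) : riesz s (g x) (g y) = riesz s x y := by
  rw [riesz, g.isometry.edist_eq, riesz]

lemma measurable_isometry : Measurable g := g.continuous.measurable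

lemma interEnergy_map (μ ν : Measure (EuclideanSpace ℝ (Fin d))) [SFinite ν] :
    interEnergy s (μ.map g) (ν.map g) = interEnergy s μ ν := by
  rw [interEnergy, lintegral_map (measurable_riesz s).lintegral_prod_right'
    (measurable_isometry g), interEnergy]
  refine lintegral_congr fun x => ?_
  rw [lintegral_map (by unfold riesz; fun_prop) (measurable_isometry g)]
  simp_rw [riesz_isometry]

/-- Moving every particle of a competitor by `g` transports its density and keeps all distances.
Applied to `g.symm` as well, this gives equality. -/
lemma minPairEnergyOf_map_le (μ : Measure (EuclideanSpace ℝ (Fin d))) :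
    minPairEnergyOf s (μ.map g) ≤ minPairEnergyOf s μ := by
  refine le_minPairEnergyOf ?_
  rintro N P hP rfl
  have hg := measurable_isometry g
  have hm : Measurable (fun (x : Fin N → EuclideanSpace ℝ (Fin d)) j => g (x j)) := by fun_prop
  have := Measure.isProbabilityMeasure_map (μ := P) hm.aemeasurable
  have h1 : density (P.map (fun x j => g (x j))) = (density P).map g := by
    rw [density, density, ← Measure.mapₗ_apply_of_measurable hg, map_sum]
    refine Finset.sum_congr rfl fun j _ => ?_
    rw [Measure.mapₗ_apply_of_measurable hg, Measure.map_map (by fun_prop) hm,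
      Measure.map_map hg (by fun_prop)]
    rfl
  rw [← h1]
  refine (minPairEnergyOf_le _).trans_eq ?_
  rw [pairEnergy, lintegral_map (measurable_sum_pair s) hm, pairEnergy]
  simp_rw [riesz_isometry]

lemma minPairEnergyOf_map (μ : Measure (EuclideanSpace ℝ (Fin d))) :
    minPairEnergyOf s (μ.map g) = minPairEnergyOf s μ := by
  refine le_antisymm (minPairEnergyOf_map_le g μ) ?_
  have h := minPairEnergyOf_map_le (s := s) g.symm (μ.map g)
  rwa [Measure.map_map (measurable_isometry _) (measurable_isometry _),
    show (g.symm ∘ g) = id by ext1 x; simp, Measure.map_id] at h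

lemma measurePreserving_isometry : MeasurePreserving g := by
  have h : (g : EuclideanSpace ℝ (Fin d) → EuclideanSpace ℝ (Fin d)) =
      (fun x => g 0 + x) ∘ g.linearIsometryEquiv := by
    ext1 x
    have := g.map_vadd 0 x
    simp only [vadd_eq_add, add_zero] at this
    simp [this, add_comm]
  rw [h]
  exact (measurePreserving_add_left volume (g 0)).comp g.linearIsometryEquiv.measurePreserving

lemma map_restrict_isometry (A : Set (EuclideanSpace ℝ (Fin d))) :
    (volume.restrict A).map g = volume.restrict (g '' A) := by
  have h := (measurePreserving_isometry g).restrict_image_emb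
    g.toHomeomorph.measurableEmbedding A
  exact h.map_eq

end Isometry

/-! ### Gaussian kernels and positive definiteness -/

/-- The Gaussian kernel `exp (-t |x - y|²)`. -/
noncomputable def gaussKernel {d : ℕ} (t : ℝ) (x y : EuclideanSpace ℝ (Fin d)) : ℝ≥0∞ :=
  ENNReal.ofReal (Real.exp (-t * ‖x - y‖ ^ 2))

/-- The superposition of Gaussian kernels with parameters in `T` that for `T = (0, ∞)` is a
multiple of the Riesz interaction. -/
noncomputable def rieszPart {d : ℕ} (s : ℝ) (T : Set ℝ) (x y : EuclideanSpace ℝ (Fin d)) : ℝ≥0∞ :=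
  ∫⁻ t in T, ENNReal.ofReal (t ^ (s / 2 - 1)) * gaussKernel t x y

@[fun_prop]
lemma measurable_gaussKernel {d : ℕ} {α : Type*} [MeasurableSpace α] {t : α → ℝ}
    {f g : α → EuclideanSpace ℝ (Fin d)} (ht : Measurable t) (hf : Measurable f)
    (hg : Measurable g) : Measurable fun a => gaussKernel (t a) (f a) (g a) := by
  unfold gaussKernel
  exact (((ht.neg).mul ((hf.sub hg).norm.pow_const 2)).exp).ennreal_ofReal

lemma measurable_rieszPart {d : ℕ} (s : ℝ) (T : Set ℝ) {α : Type*} [MeasurableSpace α]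
    {f g : α → EuclideanSpace ℝ (Fin d)} (hf : Measurable f) (hg : Measurable g) :
    Measurable fun a => rieszPart s T (f a) (g a) := by
  unfold rieszPart
  refine Measurable.lintegral_prod_right' (f := fun p : α × ℝ =>
    ENNReal.ofReal (p.2 ^ (s / 2 - 1)) * gaussKernel p.2 (f p.1) (g p.1)) ?_
  exact (measurable_snd.pow_const _).ennreal_ofReal.mul
    (measurable_gaussKernel measurable_snd (hf.comp measurable_fst) (hg.comp measurable_fst))

lemma gaussKernel_le_one {d : ℕ} {t : ℝ} (ht : 0 ≤ t) (x y : EuclideanSpace ℝ (Fin d)) :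
    gaussKernel t x y ≤ 1 := by
  rw [gaussKernel, ENNReal.ofReal_le_one, Real.exp_le_one_iff]
  have := mul_nonneg ht (sq_nonneg ‖x - y‖)
  linarith

lemma gaussKernel_comm {d : ℕ} (t : ℝ) (x y : EuclideanSpace ℝ (Fin d)) :
    gaussKernel t x y = gaussKernel t y x := by
  rw [gaussKernel, gaussKernel, norm_sub_rev]

lemma lintegral_gaussKernel {d : ℕ} {t : ℝ} (ht : 0 < t) (x : EuclideanSpace ℝ (Fin d)) :
    ∫⁻ y, gaussKernel t x y = ENNReal.ofReal ((Real.pi / t) ^ ((d : ℝ) / 2)) := by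
  have h0 := GaussianFourier.integral_rexp_neg_mul_sq_norm (V := EuclideanSpace ℝ (Fin d)) ht
  have hint : Integrable fun v : EuclideanSpace ℝ (Fin d) => Real.exp (-t * ‖v‖ ^ 2) := by
    -- A non-integrable function would have Bochner integral `0`, whereas the closed formula is
    -- positive.
    by_contra h
    rw [integral_undef h] at h0
    have : 0 < (Real.pi / t) ^ ((Module.finrank ℝ (EuclideanSpace ℝ (Fin d)) : ℝ) / 2) := by
      have := Real.pi_pos
      positivity
    linarith
  simp only [gaussKernel]
  rw [lintegral_sub_left_eq_self (fun v : EuclideanSpace ℝ (Fin d) =>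
    ENNReal.ofReal (Real.exp (-t * ‖v‖ ^ 2))) x,
    ← ofReal_integral_eq_lintegral_ofReal hint (ae_of_all _ fun _ => (Real.exp_pos _).le), h0]
  simp

/-- Centred at the midpoint of `x` and `y`, the two exponents add up by the parallelogram law. A
Gaussian is thus, up to a constant, a convolution square, which is the source of its positive
definiteness. -/
lemma lintegral_gaussKernel_mul {d : ℕ} {t : ℝ} (x y : EuclideanSpace ℝ (Fin d)) :
    ∫⁻ z, gaussKernel (2 * t) x z * gaussKernel (2 * t) y z =
      gaussKernel t x y * ∫⁻ z, gaussKernel (4 * t) (0 : EuclideanSpace ℝ (Fin d)) z := by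
  rw [← lintegral_const_mul _ (by fun_prop), ← lintegral_sub_left_eq_self _ ((1 / 2 : ℝ) • (x + y))]
  refine lintegral_congr fun z => ?_
  simp only [gaussKernel]
  rw [← ENNReal.ofReal_mul (Real.exp_pos _).le, ← ENNReal.ofReal_mul (Real.exp_pos _).le,
    ← Real.exp_add, ← Real.exp_add]
  congr 2
  set w := (1 / 2 : ℝ) • (x - y) with hw
  have e1 : x - ((1 / 2 : ℝ) • (x + y) - z) = z + w := by rw [hw]; module
  have e2 : y - ((1 / 2 : ℝ) • (x + y) - z) = z - w := by rw [hw]; module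
  have e3 : x - y = (2 : ℝ) • w := by rw [hw]; module
  rw [e1, e2, e3, norm_smul, zero_sub, norm_neg]
  have := parallelogram_law_with_norm ℝ z w
  norm_num
  linear_combination (-2 * t) * this

lemma sq_lintegral_le {α : Type*} [MeasurableSpace α] (P : Measure α) [IsProbabilityMeasure P]
    {f : α → ℝ≥0∞} (hf : AEMeasurable f P) : (∫⁻ x, f x ∂P) ^ 2 ≤ ∫⁻ x, f x ^ 2 ∂P := by
  have h := ENNReal.lintegral_mul_le_Lp_mul_Lq P Real.HolderConjugate.two_two hf
    (aemeasurable_const (b := (1 : ℝ≥0∞)))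
  simp only [Pi.mul_apply, mul_one, ENNReal.one_rpow, lintegral_const, measure_univ] at h
  calc (∫⁻ x, f x ∂P) ^ 2 ≤ ((∫⁻ x, f x ^ (2 : ℝ) ∂P) ^ (1 / 2 : ℝ)) ^ 2 := by gcongr
    _ = ∫⁻ x, f x ^ 2 ∂P := by
      rw [← ENNReal.rpow_natCast, ← ENNReal.rpow_mul]
      norm_num

instance {d N : ℕ} (P : Measure (Fin N → EuclideanSpace ℝ (Fin d))) [IsProbabilityMeasure P] :
    IsFiniteMeasure (density P) := by
  refine ⟨?_⟩
  rw [density, Measure.finsetSum_apply]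
  simp [ENNReal.sum_lt_top]

lemma density_univ {d N : ℕ} (P : Measure (Fin N → EuclideanSpace ℝ (Fin d)))
    [IsProbabilityMeasure P] : density P Set.univ = N := by
  rw [density, Measure.finsetSum_apply]
  have (j : Fin N) : P.map (fun x => x j) Set.univ = 1 := by
    rw [Measure.map_apply (by fun_prop) MeasurableSet.univ]; simp
  simp [this]

/-- Positive definiteness of the Gaussian kernel. -/
lemma lintegral_gaussKernel_density_le {d N : ℕ} {t : ℝ} (ht : 0 < t)
    (P : Measure (Fin N → EuclideanSpace ℝ (Fin d))) [IsProbabilityMeasure P] :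
    ∫⁻ x, ∫⁻ y, gaussKernel t x y ∂(density P) ∂(density P) ≤
      ∫⁻ x, ∑ j, ∑ k, gaussKernel t (x j) (x k) ∂P := by
  set K := ∫⁻ z, gaussKernel (4 * t) (0 : EuclideanSpace ℝ (Fin d)) z with hK
  have hKval := lintegral_gaussKernel (d := d) (t := 4 * t) (by positivity) 0
  have hK0 : K ≠ 0 := by
    rw [hK, hKval, ne_eq, ENNReal.ofReal_eq_zero, not_le]
    have := Real.pi_pos
    positivity
  have hKtop : K ≠ ∞ := by rw [hK, hKval]; exact ENNReal.ofReal_ne_top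
  -- The factor `K` turns both kernels into integrals over `z`. With `F = ∑ j, gaussKernel (2 * t)
  -- (x j) z`, the left side becomes the integral of the squared mean of `F` and the right side that
  -- of the mean of `F²`.
  rw [← ENNReal.mul_le_mul_iff_left hK0 hKtop]
  have mG (c : ℝ) {α : Type} [MeasurableSpace α] {f g : α → EuclideanSpace ℝ (Fin d)}
    (hf : Measurable f) (hg : Measurable g) : Measurable fun a => gaussKernel c (f a) (g a) :=
    measurable_gaussKernel measurable_const hf hg
  have m1 : Measurable fun p : EuclideanSpace ℝ (Fin d) × EuclideanSpace ℝ (Fin d) =>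
    gaussKernel (2 * t) p.1 p.2 := mG _ measurable_fst measurable_snd
  have hL : (∫⁻ x, ∫⁻ y, gaussKernel t x y ∂(density P) ∂(density P)) * K =
      ∫⁻ z, (∫⁻ x, gaussKernel (2 * t) x z ∂(density P)) ^ 2 := by
    rw [← lintegral_mul_const _ (Measurable.lintegral_prod_right' (mG t measurable_fst
      measurable_snd))]
    calc _ = ∫⁻ x, ∫⁻ y, ∫⁻ z, gaussKernel (2 * t) x z * gaussKernel (2 * t) y z
          ∂volume ∂(density P) ∂(density P) := by
          refine lintegral_congr fun x => ?_
          rw [← lintegral_mul_const _ (by fun_prop)]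
          exact lintegral_congr fun y => (lintegral_gaussKernel_mul x y).symm
      _ = ∫⁻ x, ∫⁻ z, ∫⁻ y, gaussKernel (2 * t) x z * gaussKernel (2 * t) y z
          ∂(density P) ∂volume ∂(density P) := by
          refine lintegral_congr fun x => ?_
          rw [lintegral_lintegral_swap]
          exact ((mG (2 * t) measurable_const measurable_snd).mul
            (mG (2 * t) measurable_fst measurable_snd)).aemeasurable
      _ = ∫⁻ x, ∫⁻ z, gaussKernel (2 * t) x z * ∫⁻ y, gaussKernel (2 * t) y z
          ∂(density P) ∂volume ∂(density P) := by
          refine lintegral_congr fun x => lintegral_congr fun z => ?_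
          rw [lintegral_const_mul _ (by fun_prop)]
      _ = ∫⁻ z, ∫⁻ x, gaussKernel (2 * t) x z * ∫⁻ y, gaussKernel (2 * t) y z
          ∂(density P) ∂(density P) ∂volume := by
          rw [lintegral_lintegral_swap]
          exact ((mG (2 * t) measurable_fst measurable_snd).mul
            (m1.lintegral_prod_left'.comp measurable_snd)).aemeasurable
      _ = _ := by
          refine lintegral_congr fun z => ?_
          rw [lintegral_mul_const _ (by fun_prop), sq]
  have hR : (∫⁻ x, ∑ j, ∑ k, gaussKernel t (x j) (x k) ∂P) * K =
      ∫⁻ z, ∫⁻ x, (∑ j, gaussKernel (2 * t) (x j) z) ^ 2 ∂P := by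
    have m2 : Measurable fun p : (Fin N → EuclideanSpace ℝ (Fin d)) × EuclideanSpace ℝ (Fin d) =>
        (∑ j, gaussKernel (2 * t) (p.1 j) p.2) ^ 2 := by
      refine Measurable.pow_const ?_ 2
      refine Finset.measurable_fun_sum _ fun j _ => mG _ (by fun_prop) measurable_snd
    have m3 : Measurable fun x : Fin N → EuclideanSpace ℝ (Fin d) =>
        ∑ j, ∑ k, gaussKernel t (x j) (x k) := by
      refine Finset.measurable_fun_sum _ fun j _ => Finset.measurable_fun_sum _ fun k _ =>
        mG _ (by fun_prop) (by fun_prop)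
    rw [← lintegral_mul_const _ m3, ← lintegral_lintegral_swap m2.aemeasurable]
    refine lintegral_congr fun x => ?_
    simp_rw [sq, Finset.sum_mul_sum]
    rw [lintegral_finsetSum _ fun j _ => by fun_prop,
      Finset.sum_mul]
    refine Finset.sum_congr rfl fun j _ => ?_
    rw [lintegral_finsetSum _ fun k _ => by fun_prop,
      Finset.sum_mul]
    exact Finset.sum_congr rfl fun k _ => (lintegral_gaussKernel_mul _ _).symm
  rw [hL, hR]
  refine lintegral_mono fun z => ?_
  rw [lintegral_density P (by fun_prop)]
  refine sq_lintegral_le P (Measurable.aemeasurable ?_)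
  exact Finset.measurable_fun_sum _ fun j _ => mG _ (by fun_prop) measurable_const

/-- Tonelli, used to transfer statements about single Gaussians to their superpositions. -/
lemma lintegral_rieszPart {d : ℕ} (s : ℝ) (T : Set ℝ) (μ ν : Measure (EuclideanSpace ℝ (Fin d)))
    [SFinite μ] [SFinite ν] :
    ∫⁻ x, ∫⁻ y, rieszPart s T x y ∂ν ∂μ =
      ∫⁻ t in T, ENNReal.ofReal (t ^ (s / 2 - 1)) * ∫⁻ x, ∫⁻ y, gaussKernel t x y ∂ν ∂μ := by
  have m3 : Measurable fun p : (ℝ × EuclideanSpace ℝ (Fin d)) × EuclideanSpace ℝ (Fin d) =>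
      gaussKernel p.1.1 p.1.2 p.2 :=
    measurable_gaussKernel (by fun_prop) (by fun_prop) (by fun_prop)
  have mφ : Measurable fun t : ℝ => ENNReal.ofReal (t ^ (s / 2 - 1)) := by fun_prop
  have m2 := m3.lintegral_prod_right' (ν := ν)
  calc _ = ∫⁻ x, ∫⁻ t in T, ∫⁻ y, ENNReal.ofReal (t ^ (s / 2 - 1)) * gaussKernel t x y
        ∂ν ∂volume ∂μ := by
        refine lintegral_congr fun x => ?_
        unfold rieszPart
        rw [lintegral_lintegral_swap]
        exact ((mφ.comp measurable_snd).mul (measurable_gaussKernel measurable_snd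
          measurable_const measurable_fst)).aemeasurable
    _ = ∫⁻ x, ∫⁻ t in T, ENNReal.ofReal (t ^ (s / 2 - 1)) * ∫⁻ y, gaussKernel t x y
        ∂ν ∂volume ∂μ := by
        refine lintegral_congr fun x => lintegral_congr fun t => ?_
        rw [lintegral_const_mul _ (by fun_prop)]
    _ = ∫⁻ t in T, ∫⁻ x, ENNReal.ofReal (t ^ (s / 2 - 1)) * ∫⁻ y, gaussKernel t x y ∂ν ∂μ := by
        rw [lintegral_lintegral_swap]
        exact ((mφ.comp measurable_snd).mul (m2.comp measurable_swap)).aemeasurable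
    _ = _ := by
        refine lintegral_congr fun t => ?_
        exact lintegral_const_mul _ (m2.comp (measurable_const.prodMk measurable_id))

lemma lintegral_rieszPart_density_le {d N : ℕ} (s : ℝ) {T : Set ℝ} (hT : MeasurableSet T)
    (hT0 : T ⊆ Set.Ioi 0) (P : Measure (Fin N → EuclideanSpace ℝ (Fin d)))
    [IsProbabilityMeasure P] :
    ∫⁻ x, ∫⁻ y, rieszPart s T x y ∂(density P) ∂(density P) ≤
      ∫⁻ x, ∑ j, ∑ k, rieszPart s T (x j) (x k) ∂P := by
  have mφ : Measurable fun t : ℝ => ENNReal.ofReal (t ^ (s / 2 - 1)) := by fun_prop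
  have m3 : Measurable fun p : ℝ × (Fin N → EuclideanSpace ℝ (Fin d)) =>
      ∑ j, ∑ k, gaussKernel p.1 (p.2 j) (p.2 k) :=
    Finset.measurable_fun_sum _ fun j _ => Finset.measurable_fun_sum _ fun k _ =>
      measurable_gaussKernel measurable_fst (by fun_prop) (by fun_prop)
  rw [lintegral_rieszPart]
  calc _ ≤ ∫⁻ t in T, ENNReal.ofReal (t ^ (s / 2 - 1)) *
        ∫⁻ x, ∑ j, ∑ k, gaussKernel t (x j) (x k) ∂P := by
        refine setLIntegral_mono' hT fun t ht => ?_
        gcongr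
        exact lintegral_gaussKernel_density_le (hT0 ht) P
    _ = ∫⁻ t in T, ∫⁻ x, ENNReal.ofReal (t ^ (s / 2 - 1)) *
        ∑ j, ∑ k, gaussKernel t (x j) (x k) ∂P := by
        refine lintegral_congr fun t => ?_
        rw [lintegral_const_mul _ (by fun_prop)]
    _ = ∫⁻ x, ∫⁻ t in T, ENNReal.ofReal (t ^ (s / 2 - 1)) *
        ∑ j, ∑ k, gaussKernel t (x j) (x k) ∂volume ∂P := by
        rw [lintegral_lintegral_swap]
        exact ((mφ.comp measurable_fst).mul m3).aemeasurable
    _ = _ := by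
        refine lintegral_congr fun x => ?_
        simp_rw [Finset.mul_sum, rieszPart]
        rw [lintegral_finsetSum _ fun j _ => by fun_prop]
        refine Finset.sum_congr rfl fun j _ => ?_
        rw [lintegral_finsetSum _ fun k _ => by fun_prop]

/-! ### Splitting the Riesz kernel and the Lieb-Oxford-type bound -/

lemma gamma_ne_zero {s : ℝ} (hs : 0 < s) : ENNReal.ofReal (Real.Gamma (s / 2)) ≠ 0 := by
  rw [ne_eq, ENNReal.ofReal_eq_zero, not_le]
  exact Real.Gamma_pos_of_pos (by positivity)

lemma riesz_self {d : ℕ} {s : ℝ} (hs : 0 < s) (x : EuclideanSpace ℝ (Fin d)) :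
    riesz s x x = ∞ := by
  rw [riesz, edist_self, ENNReal.zero_rpow_of_neg (by linarith)]

/-- The Riesz interaction is a superposition of Gaussians. -/
lemma rieszPart_Ioi_zero {d : ℕ} {s : ℝ} (hs : 0 < s) {x y : EuclideanSpace ℝ (Fin d)}
    (hxy : x ≠ y) :
    rieszPart s (Set.Ioi 0) x y = ENNReal.ofReal (Real.Gamma (s / 2)) * riesz s x y := by
  have hn : 0 < ‖x - y‖ := norm_pos_iff.2 (sub_ne_zero.2 hxy)
  have h0 := Real.integral_rpow_mul_exp_neg_mul_Ioi (a := s / 2) (r := ‖x - y‖ ^ 2)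
    (by positivity) (by positivity)
  have hΓ := Real.Gamma_pos_of_pos (s := s / 2) (by positivity)
  have hint : IntegrableOn (fun t : ℝ => t ^ (s / 2 - 1) * Real.exp (-(‖x - y‖ ^ 2 * t)))
      (Set.Ioi 0) := by
    by_contra h
    rw [integral_undef h] at h0
    have : 0 < (1 / ‖x - y‖ ^ 2) ^ (s / 2) * Real.Gamma (s / 2) := by positivity
    linarith
  have hnn : 0 ≤ᵐ[volume.restrict (Set.Ioi 0)]
      fun t : ℝ => t ^ (s / 2 - 1) * Real.exp (-(‖x - y‖ ^ 2 * t)) := by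
    filter_upwards [ae_restrict_mem measurableSet_Ioi] with t ht
    have : (0 : ℝ) < t := ht
    simp only [Pi.zero_apply]
    positivity
  have h1 : rieszPart s (Set.Ioi 0) x y =
      ∫⁻ t in Set.Ioi 0, ENNReal.ofReal (t ^ (s / 2 - 1) * Real.exp (-(‖x - y‖ ^ 2 * t))) := by
    refine setLIntegral_congr_fun measurableSet_Ioi fun t ht => ?_
    have : (0 : ℝ) < t := ht
    simp only [gaussKernel]
    rw [ENNReal.ofReal_mul (by positivity)]
    ring_nf
  rw [h1, ← ofReal_integral_eq_lintegral_ofReal hint hnn, h0, mul_comm,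
    ENNReal.ofReal_mul hΓ.le, riesz, edist_dist, dist_eq_norm, ENNReal.ofReal_rpow_of_pos hn]
  congr 2
  rw [one_div, Real.inv_rpow (by positivity), ← Real.rpow_natCast, ← Real.rpow_mul hn.le,
    Real.rpow_neg hn.le]
  congr 2
  push_cast
  ring

lemma rieszPart_le {d : ℕ} {s : ℝ} (hs : 0 < s) {T : Set ℝ} (hT : T ⊆ Set.Ioi 0)
    (x y : EuclideanSpace ℝ (Fin d)) :
    rieszPart s T x y ≤ ENNReal.ofReal (Real.Gamma (s / 2)) * riesz s x y := by
  rcases eq_or_ne x y with rfl | hxy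
  · rw [riesz_self hs, ENNReal.mul_top (gamma_ne_zero hs)]
    exact le_top
  · rw [← rieszPart_Ioi_zero hs hxy]
    exact lintegral_mono_set hT

/-- The value on the diagonal of the long-range part of the interaction. -/
noncomputable def longRangeConst (s : ℝ) : ℝ≥0∞ :=
  ∫⁻ t in Set.Ioc (0 : ℝ) 1, ENNReal.ofReal (t ^ (s / 2 - 1))

lemma longRangeConst_lt_top {s : ℝ} (hs : 0 < s) : longRangeConst s < ∞ := by
  have h : IntegrableOn (fun t : ℝ => t ^ (s / 2 - 1)) (Set.Ioc 0 1) := by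
    rw [← intervalIntegrable_iff_integrableOn_Ioc_of_le zero_le_one]
    exact intervalIntegral.intervalIntegrable_rpow' (by linarith)
  exact h.lintegral_lt_top

lemma rieszPart_Ioc_le {d : ℕ} (s : ℝ) (x y : EuclideanSpace ℝ (Fin d)) :
    rieszPart s (Set.Ioc 0 1) x y ≤ longRangeConst s := by
  refine setLIntegral_mono' measurableSet_Ioc fun t ht => ?_
  exact mul_le_of_le_one_right zero_le (gaussKernel_le_one ht.1.le x y)

/-- The integral of the short-range part of the interaction. -/
noncomputable def shortRangeConst (d : ℕ) (s : ℝ) : ℝ≥0∞ :=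
  ∫⁻ t in Set.Ioi (1 : ℝ), ENNReal.ofReal (t ^ (s / 2 - 1)) *
    ENNReal.ofReal ((Real.pi / t) ^ ((d : ℝ) / 2))

lemma shortRangeConst_lt_top {d : ℕ} {s : ℝ} (hsd : s < d) : shortRangeConst d s < ∞ := by
  have h : IntegrableOn (fun t : ℝ => Real.pi ^ ((d : ℝ) / 2) * t ^ (s / 2 - 1 - d / 2))
      (Set.Ioi 1) :=
    (integrableOn_Ioi_rpow_of_lt (by linarith) one_pos).const_mul _
  refine lt_of_eq_of_lt ?_ h.lintegral_lt_top
  refine setLIntegral_congr_fun measurableSet_Ioi fun t ht => ?_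
  have ht0 : (0 : ℝ) < t := zero_lt_one.trans ht
  rw [← ENNReal.ofReal_mul (by positivity), Real.div_rpow Real.pi_pos.le ht0.le,
    Real.rpow_sub ht0 (s / 2 - 1)]
  congr 1
  ring

lemma lintegral_rieszPart_Ioi_one {d : ℕ} (s : ℝ) (x : EuclideanSpace ℝ (Fin d)) :
    ∫⁻ y, rieszPart s (Set.Ioi 1) x y = shortRangeConst d s := by
  have h := lintegral_rieszPart s (Set.Ioi 1) (Measure.dirac x) volume
  simp only [lintegral_dirac] at h
  rw [h]
  refine setLIntegral_congr_fun measurableSet_Ioi fun t ht => ?_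
  rw [lintegral_gaussKernel (zero_lt_one.trans ht)]

/-- Only the short-range part is estimated: extending its inner integral from `A` to the whole space
gives a constant for each `x`. The long-range part is kept for the positive-definiteness argument.
-/
lemma interEnergy_restrict_le {d : ℕ} {s : ℝ} (hs : 0 < s) (hsd : s < d)
    (A : Set (EuclideanSpace ℝ (Fin d))) :
    ENNReal.ofReal (Real.Gamma (s / 2)) *
        interEnergy s (volume.restrict A) (volume.restrict A) ≤
      (∫⁻ x in A, ∫⁻ y in A, rieszPart s (Set.Ioc 0 1) x y) +
        volume A * shortRangeConst d s := by
  have hd : 0 < d := by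
    have := hs.trans hsd
    exact_mod_cast this
  have : Nontrivial (EuclideanSpace ℝ (Fin d)) := by
    have : Nonempty (Fin d) := ⟨⟨0, hd⟩⟩
    infer_instance
  have m1 : Measurable fun x : EuclideanSpace ℝ (Fin d) =>
      ∫⁻ y in A, rieszPart s (Set.Ioc 0 1) x y :=
    (measurable_rieszPart s _ measurable_fst measurable_snd).lintegral_prod_right'
  have key (x : EuclideanSpace ℝ (Fin d)) :
      ENNReal.ofReal (Real.Gamma (s / 2)) * ∫⁻ y in A, riesz s x y ≤
        (∫⁻ y in A, rieszPart s (Set.Ioc 0 1) x y) + shortRangeConst d s := by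
    rw [← lintegral_const_mul _ (by unfold riesz; fun_prop),
      ← lintegral_rieszPart_Ioi_one s x]
    -- The Gaussian representation is available off the diagonal only; in positive dimension a
    -- single point is null.
    have hae : ∀ᵐ y ∂(volume.restrict A), x ≠ y := by
      refine ae_restrict_of_ae ?_
      have := (measure_eq_zero_iff_ae_notMem (μ := volume)).1 (measure_singleton x)
      filter_upwards [this] with y hy h
      exact hy h.symm
    calc _ = ∫⁻ y in A, (rieszPart s (Set.Ioc 0 1) x y + rieszPart s (Set.Ioi 1) x y) := by
          refine lintegral_congr_ae ?_
          filter_upwards [hae] with y hy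
          rw [← rieszPart_Ioi_zero hs hy, rieszPart, ← Set.Ioc_union_Ioi_eq_Ioi zero_le_one,
            lintegral_union measurableSet_Ioi Set.Ioc_disjoint_Ioi_same]
          rfl
      _ = (∫⁻ y in A, rieszPart s (Set.Ioc 0 1) x y) +
          ∫⁻ y in A, rieszPart s (Set.Ioi 1) x y :=
          lintegral_add_left (measurable_rieszPart s _ measurable_const measurable_id) _
      _ ≤ _ := by
          gcongr
          exact Measure.restrict_le_self
  rw [interEnergy, ← lintegral_const_mul _ (measurable_riesz s).lintegral_prod_right']
  calc _ ≤ ∫⁻ x in A, ((∫⁻ y in A, rieszPart s (Set.Ioc 0 1) x y) + shortRangeConst d s) :=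
        lintegral_mono key
    _ = _ := by
        rw [lintegral_add_left m1, lintegral_const, Measure.restrict_apply_univ, mul_comm (volume A)]

lemma interEnergy_restrict_ne_top {d : ℕ} {s : ℝ} (hs : 0 < s) (hsd : s < d)
    {A : Set (EuclideanSpace ℝ (Fin d))} (hA : volume A ≠ ∞) :
    interEnergy s (volume.restrict A) (volume.restrict A) ≠ ∞ := by
  have h := interEnergy_restrict_le hs hsd A
  have h2 : (∫⁻ x in A, ∫⁻ y in A, rieszPart s (Set.Ioc 0 1) x y) ≤
      longRangeConst s * volume A * volume A := by
    calc _ ≤ ∫⁻ _ in A, ∫⁻ _ in A, longRangeConst s :=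
          lintegral_mono fun x => lintegral_mono fun y => rieszPart_Ioc_le s x y
      _ = _ := by simp
  intro htop
  rw [htop, ENNReal.mul_top (gamma_ne_zero hs), top_le_iff] at h
  refine absurd h (ENNReal.add_ne_top.2 ⟨ne_top_of_le_ne_top ?_ h2, ?_⟩)
  · exact ENNReal.mul_ne_top (ENNReal.mul_ne_top (longRangeConst_lt_top hs).ne hA) hA
  · exact ENNReal.mul_ne_top hA (shortRangeConst_lt_top hsd).ne

/-- Positive definiteness bounds the full double sum, self-interactions included. Removing the
diagonal costs `c` per particle, which requires a kernel bounded there. -/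
lemma sum_sum_le_pair {α : Type*} {N : ℕ} (w : α → α → ℝ≥0∞) (hw : ∀ x y, w x y = w y x)
    {c : ℝ≥0∞} (hc : ∀ x, w x x ≤ c) (x : Fin N → α) :
    ∑ j, ∑ k, w (x j) (x k) ≤ N * c + 2 * ∑ j : Fin N, ∑ k ∈ Finset.Ioi j, w (x j) (x k) := by
  have h1 : ∀ j k : Fin N, w (x j) (x k) = (if j = k then w (x j) (x k) else 0) +
      (if j < k then w (x j) (x k) else 0) + (if k < j then w (x k) (x j) else 0) := by
    intro j k
    rcases lt_trichotomy j k with h | h | h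
    · simp [h, h.ne, h.asymm]
    · simp [h]
    · simp [h, h.ne', h.asymm, hw (x j)]
  calc ∑ j, ∑ k, w (x j) (x k) = ∑ j, ∑ k, ((if j = k then w (x j) (x k) else 0) +
      (if j < k then w (x j) (x k) else 0) + (if k < j then w (x k) (x j) else 0)) :=
        Finset.sum_congr rfl fun j _ => Finset.sum_congr rfl fun k _ => h1 j k
    _ = (∑ j, w (x j) (x j)) + 2 * ∑ j : Fin N, ∑ k ∈ Finset.Ioi j, w (x j) (x k) := by
        simp_rw [Finset.sum_add_distrib]
        rw [sum_pair_eq_sum_ite, Finset.sum_comm (f := fun j k => if k < j then _ else _)]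
        simp only [Finset.sum_ite_eq, Finset.mem_univ, if_true]
        ring
    _ ≤ _ := by
        gcongr
        calc _ ≤ ∑ _ : Fin N, c := Finset.sum_le_sum fun j _ => hc _
          _ = _ := by simp

/-- The Lieb-Oxford-type lower bound for densities that are indicators. -/
theorem exists_direct_le_minPairEnergyOf {d : ℕ} {s : ℝ} (hs : 0 < s) (hsd : s < d) :
    ∃ κ : ℝ≥0∞, κ ≠ ∞ ∧ ∀ A : Set (EuclideanSpace ℝ (Fin d)),
      2⁻¹ * interEnergy s (volume.restrict A) (volume.restrict A) ≤
        minPairEnergyOf s (volume.restrict A) + κ * volume A := by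
  set Γ := ENNReal.ofReal (Real.Gamma (s / 2)) with hΓ
  have hΓ0 : Γ ≠ 0 := gamma_ne_zero hs
  have hΓt : Γ ≠ ∞ := ENNReal.ofReal_ne_top
  set c := longRangeConst s + shortRangeConst d s with hc
  refine ⟨2⁻¹ * Γ⁻¹ * c, ?_, fun A => ?_⟩
  · exact ENNReal.mul_ne_top (ENNReal.mul_ne_top (by simp) (by simp [hΓ0]))
      (ENNReal.add_ne_top.2 ⟨(longRangeConst_lt_top hs).ne, (shortRangeConst_lt_top hsd).ne⟩)
  refine (?_ : _ ≤ minPairEnergyOf s (volume.restrict A) + _)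
  -- The volume term is moved to the left so that the infimum can be tested on one competitor at a
  -- time.
  rw [← tsub_le_iff_right]
  refine le_minPairEnergyOf fun N P hP hPA => ?_
  rw [tsub_le_iff_right]
  -- This converts the self-interaction cost, proportional to the number of particles, into a cost
  -- per volume.
  have hN : volume A = N := by
    rw [← density_univ P, hPA, Measure.restrict_apply_univ]
  have h1 := interEnergy_restrict_le hs hsd A
  have h2 := lintegral_rieszPart_density_le s measurableSet_Ioc
    (fun t (ht : t ∈ Set.Ioc (0 : ℝ) 1) => ht.1) P
  rw [hPA] at h2
  have h3 : ∫⁻ x, ∑ j, ∑ k, rieszPart s (Set.Ioc 0 1) (x j) (x k) ∂P ≤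
      N * longRangeConst s + 2 * (Γ * pairEnergy s P) := by
    calc _ ≤ ∫⁻ x, (N * longRangeConst s +
          2 * (Γ * ∑ j : Fin N, ∑ k ∈ Finset.Ioi j, riesz s (x j) (x k))) ∂P := by
          refine lintegral_mono fun x => ?_
          refine (sum_sum_le_pair (rieszPart s (Set.Ioc 0 1)) (fun x y => ?_)
            (fun x => rieszPart_Ioc_le s x x) x).trans ?_
          · simp_rw [rieszPart, gaussKernel_comm _ x y]
          · simp_rw [Finset.mul_sum]
            gcongr
            exact rieszPart_le hs (fun t ht => ht.1) _ _
      _ = _ := by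
          rw [lintegral_add_left measurable_const, lintegral_const_mul _
            ((measurable_sum_pair s).const_mul _), lintegral_const_mul _ (measurable_sum_pair s)]
          simp [pairEnergy]
  have h4 : Γ * interEnergy s (volume.restrict A) (volume.restrict A) ≤
      2 * (Γ * pairEnergy s P) + c * volume A := by
    refine h1.trans ((add_le_add (h2.trans h3) le_rfl).trans_eq ?_)
    rw [hN, hc]; ring
  have hcancel : Γ⁻¹ * Γ = 1 := ENNReal.inv_mul_cancel hΓ0 hΓt
  have hcancel2 : (2 : ℝ≥0∞)⁻¹ * 2 = 1 := ENNReal.inv_mul_cancel (by simp) (by simp)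
  calc 2⁻¹ * interEnergy s (volume.restrict A) (volume.restrict A)
      = 2⁻¹ * (Γ⁻¹ * Γ) * interEnergy s (volume.restrict A) (volume.restrict A) := by
        rw [hcancel, mul_one]
    _ = 2⁻¹ * Γ⁻¹ * (Γ * interEnergy s (volume.restrict A) (volume.restrict A)) := by ring
    _ ≤ 2⁻¹ * Γ⁻¹ * (2 * (Γ * pairEnergy s P) + c * volume A) := by gcongr
    _ = (2⁻¹ * 2) * (Γ⁻¹ * Γ) * pairEnergy s P + 2⁻¹ * Γ⁻¹ * c * volume A := by ring
    _ = _ := by rw [hcancel, hcancel2]; ring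

/-! ### The indirect energy of sets of integer volume -/

section SetEnergy

variable {d : ℕ} {s : ℝ} {A B : Set (EuclideanSpace ℝ (Fin d))}

lemma setEnergy_eq (hA : MeasurableSet A) :
    setEnergy s A = (minPairEnergyOf s (volume.restrict A)).toReal -
      (2⁻¹ * interEnergy s (volume.restrict A) (volume.restrict A)).toReal := by
  rw [setEnergy, indirectEnergy, minPairEnergy_indicator s hA, directEnergy_indicator s hA]

lemma setEnergy_congr_ae (hA : MeasurableSet A) (hB : MeasurableSet B)
    (h : A =ᵐ[volume] B) : setEnergy s A = setEnergy s B := by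
  rw [setEnergy_eq hA, setEnergy_eq hB, Measure.restrict_congr_set h]

lemma setEnergy_image (hA : MeasurableSet A)
    (g : EuclideanSpace ℝ (Fin d) ≃ᵃⁱ[ℝ] EuclideanSpace ℝ (Fin d)) :
    setEnergy s (g '' A) = setEnergy s A := by
  rw [setEnergy_eq hA, setEnergy_eq (A := g '' A) (g.toHomeomorph.measurableEmbedding.measurableSet_image' hA),
    ← map_restrict_isometry, minPairEnergyOf_map, interEnergy_map]

lemma direct_ne_top (hs : 0 < s) (hsd : s < d) (hA : volume A ≠ ∞) :
    2⁻¹ * interEnergy s (volume.restrict A) (volume.restrict A) ≠ ∞ :=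
  ENNReal.mul_ne_top (by simp) (interEnergy_restrict_ne_top hs hsd hA)

lemma minPairEnergyOf_restrict_le {N : ℕ} (hN : volume A = N) :
    minPairEnergyOf s (volume.restrict A) ≤
      2⁻¹ * interEnergy s (volume.restrict A) (volume.restrict A) :=
  minPairEnergyOf_le_direct s _ (N := N) (by rw [Measure.restrict_apply_univ, hN])

/-- Integrality of the volume ensures that a competitor exists. Finiteness here keeps the `toReal`
in `setEnergy` faithful. -/
lemma minPairEnergyOf_ne_top (hs : 0 < s) (hsd : s < d) {N : ℕ} (hN : volume A = N) :
    minPairEnergyOf s (volume.restrict A) ≠ ∞ :=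
  ne_top_of_le_ne_top (direct_ne_top hs hsd (by simp [hN])) (minPairEnergyOf_restrict_le hN)

lemma setEnergy_nonpos (hs : 0 < s) (hsd : s < d) (hA : MeasurableSet A) {N : ℕ}
    (hN : volume A = N) : setEnergy s A ≤ 0 := by
  rw [setEnergy_eq hA, sub_nonpos]
  exact ENNReal.toReal_mono (direct_ne_top hs hsd (by simp [hN])) (minPairEnergyOf_restrict_le hN)

theorem exists_neg_le_setEnergy (hs : 0 < s) (hsd : s < d) :
    ∃ κ : ℝ, ∀ A : Set (EuclideanSpace ℝ (Fin d)), MeasurableSet A → ∀ N : ℕ, volume A = N →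
      -(κ * N) ≤ setEnergy s A := by
  obtain ⟨κ, hκ, h⟩ := exists_direct_le_minPairEnergyOf hs hsd
  refine ⟨κ.toReal, fun A hA N hN => ?_⟩
  have h1 := h A
  have hm := minPairEnergyOf_ne_top hs hsd hN
  have hk : κ * volume A ≠ ∞ := ENNReal.mul_ne_top hκ (by simp [hN])
  have h2 := ENNReal.toReal_mono (ENNReal.add_ne_top.2 ⟨hm, hk⟩) h1
  rw [ENNReal.toReal_add hm hk, ENNReal.toReal_mul (a := κ), hN, ENNReal.toReal_natCast] at h2
  rw [setEnergy_eq hA]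
  linarith

/-- The interaction between `A` and `B` occurs once in the bound for the minimal pair energy and
once in the direct energy; being finite, it cancels. -/
theorem setEnergy_union_le (hs : 0 < s) (hsd : s < d) (hA : MeasurableSet A)
    (hB : MeasurableSet B) (hAB : Disjoint A B) {N M : ℕ} (hN : volume A = N)
    (hM : volume B = M) : setEnergy s (A ∪ B) ≤ setEnergy s A + setEnergy s B := by
  have hU : volume (A ∪ B) = (N + M : ℕ) := by rw [measure_union hAB hB, hN, hM]; simp
  have h1 := minPairEnergyOf_add_le s (volume.restrict A) (volume.restrict B)
  have h2 := interEnergy_add_self (s := s) (volume.restrict A) (volume.restrict B)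
  have hD := direct_ne_top hs hsd (A := A ∪ B) (by simp [hU])
  have hmA := minPairEnergyOf_ne_top hs hsd hN
  have hmB := minPairEnergyOf_ne_top hs hsd hM
  have hdA := direct_ne_top hs hsd (A := A) (by simp [hN])
  have hdB := direct_ne_top hs hsd (A := B) (by simp [hM])
  rw [← Measure.restrict_union hAB hB] at h1 h2
  have hI : interEnergy s (volume.restrict A) (volume.restrict B) ≠ ∞ := by
    rw [h2] at hD
    exact (ENNReal.add_ne_top.1 hD).2
  have h1' := ENNReal.toReal_mono (ENNReal.add_ne_top.2 ⟨ENNReal.add_ne_top.2 ⟨hmA, hmB⟩, hI⟩) h1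
  rw [ENNReal.toReal_add (ENNReal.add_ne_top.2 ⟨hmA, hmB⟩) hI, ENNReal.toReal_add hmA hmB] at h1'
  rw [setEnergy_eq hA, setEnergy_eq hB, setEnergy_eq (hA.union hB), h2,
    ENNReal.toReal_add (ENNReal.add_ne_top.2 ⟨hdA, hdB⟩) hI, ENNReal.toReal_add hdA hdB]
  linarith

end SetEnergy

/-! ### Filling a set with tiles -/

section Packing

variable {d : ℕ} {s : ℝ}

lemma setEnergy_biUnion_le (hs : 0 < s) (hsd : s < d) {ι : Type*} (F : Finset ι)
    {T : ι → Set (EuclideanSpace ℝ (Fin d))} (hT : ∀ i, MeasurableSet (T i))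
    (hdisj : Pairwise (Function.onFun Disjoint T)) {M : ℕ} (hM : ∀ i, volume (T i) = M) {ε : ℝ}
    (hε : ∀ i, setEnergy s (T i) = ε) :
    volume (⋃ i ∈ F, T i) = (F.card * M : ℕ) ∧ setEnergy s (⋃ i ∈ F, T i) ≤ F.card * ε := by
  classical
  induction F using Finset.induction_on with
  | empty =>
    have h := setEnergy_nonpos hs hsd MeasurableSet.empty
      (N := 0) (by simp : volume (∅ : Set (EuclideanSpace ℝ (Fin d))) = (0 : ℕ))
    simpa using h
  | insert i F hi ih =>
    have hd : Disjoint (T i) (⋃ j ∈ F, T j) := by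
      simp only [Set.disjoint_iUnion_right]
      exact fun j hj => hdisj fun h => hi (h ▸ hj)
    have hm : MeasurableSet (⋃ j ∈ F, T j) := F.measurableSet_biUnion fun j _ => hT j
    rw [Finset.set_biUnion_insert, Finset.card_insert_of_notMem hi]
    refine ⟨?_, ?_⟩
    · rw [measure_union hd hm, hM, ih.1]
      push_cast
      ring
    · refine (setEnergy_union_le hs hsd (hT i) hm hd (hM i) ih.1).trans ?_
      rw [hε]
      push_cast
      linarith [ih.2]

/-- If `A` is covered, up to the set `S`, by the tiles inside it, then the energy of `A` is
bounded by the energy per volume of a tile. -/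
theorem setEnergy_le_of_tiles (hs : 0 < s) (hsd : s < d) {ι : Type*}
    {T : ι → Set (EuclideanSpace ℝ (Fin d))} (hT : ∀ i, MeasurableSet (T i))
    (hdisj : Pairwise (Function.onFun Disjoint T)) {M : ℕ} (hM0 : 0 < M)
    (hM : ∀ i, volume (T i) = M) {ε : ℝ} (hε : ∀ i, setEnergy s (T i) = ε) (hε0 : ε ≤ 0)
    {A S : Set (EuclideanSpace ℝ (Fin d))}
    (hA : MeasurableSet A) {N : ℕ} (hN : volume A = N) (hS : volume S ≠ ∞)
    (hcov : ∀ x ∈ A, x ∉ S → ∃ i, x ∈ T i ∧ T i ⊆ A) :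
    setEnergy s A ≤ (volume.real A - volume.real S) * (ε / M) := by
  classical
  -- Disjoint sets of the same positive volume cannot be infinitely many inside a set of finite
  -- volume.
  have hfin : {i | T i ⊆ A}.Finite := by
    have h := Measure.finite_const_le_meas_of_disjoint_iUnion (volume.restrict A)
      (ε := M) (by exact_mod_cast hM0) hT hdisj
      (ne_top_of_le_ne_top (by simp [hN]) (measure_mono (Set.subset_univ _)))
    refine h.subset fun i hi => ?_
    simp only [Set.mem_ofPred_eq] at hi ⊢
    rw [Measure.restrict_apply (hT i), Set.inter_eq_left.2 hi, hM]
  set F := hfin.toFinset with hF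
  obtain ⟨hv, he⟩ := setEnergy_biUnion_le hs hsd F hT hdisj hM hε
  set U := ⋃ i ∈ F, T i with hU
  have hUm : MeasurableSet U := F.measurableSet_biUnion fun j _ => hT j
  have hUA : U ⊆ A := Set.iUnion₂_subset fun i hi => by simpa [hF] using hi
  have hUt : volume U ≠ ∞ := hv ▸ ENNReal.natCast_ne_top _
  -- Tiles and `A` have integer volume, hence so does the remainder, and its energy is nonpositive
  -- and may be dropped.
  have hdiff : volume (A \ U) = (N - F.card * M : ℕ) := by
    rw [measure_sdiff hUA hUm.nullMeasurableSet hUt, hN, hv, ENNReal.natCast_sub]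
  have h1 : setEnergy s A ≤ F.card * ε := by
    have h2 := setEnergy_union_le hs hsd hUm (hA.diff hUm) Set.disjoint_sdiff_right hv hdiff
    rw [Set.union_sdiff_cancel hUA] at h2
    linarith [setEnergy_nonpos hs hsd (hA.diff hUm) hdiff]
  have hsub : A ⊆ U ∪ S := fun x hx => by
    by_cases hxS : x ∈ S
    · exact Or.inr hxS
    · obtain ⟨i, hi, hiA⟩ := hcov x hx hxS
      exact Or.inl (Set.mem_biUnion (by simpa [hF] using hiA) hi)
  have h3 : volume.real A ≤ F.card * M + volume.real S := by
    refine (measureReal_mono hsub (measure_union_ne_top hUt hS)).trans ?_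
    refine (measureReal_union_le _ _).trans_eq ?_
    rw [measureReal_def (s := U), hv]
    simp
  have hM0' : (0 : ℝ) < M := by exact_mod_cast hM0
  calc setEnergy s A ≤ F.card * ε := h1
    _ = (F.card * M) * (ε / M) := by field_simp
    _ ≤ _ := mul_le_mul_of_nonpos_right (by linarith)
        (div_nonpos_of_nonpos_of_nonneg hε0 hM0'.le)

end Packing

/-! ### Cubes and grids -/

section Box

variable {d : ℕ} {s : ℝ}

/-- The half-open cube with side `m` and lower corner `a`. -/
def box {d : ℕ} (m : ℝ) (a : Fin d → ℝ) : Set (EuclideanSpace ℝ (Fin d)) :=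
  {x | ∀ i, a i ≤ x i ∧ x i < a i + m}

lemma box_eq_preimage (m : ℝ) (a : Fin d → ℝ) :
    box m a = (WithLp.ofLp : EuclideanSpace ℝ (Fin d) → (Fin d → ℝ)) ⁻¹'
      (Set.univ.pi fun i => Set.Ico (a i) (a i + m)) := by
  ext x; simp [box]

lemma measurableSet_box (m : ℝ) (a : Fin d → ℝ) : MeasurableSet (box m a) := by
  rw [box_eq_preimage]
  exact (PiLp.volume_preserving_ofLp (Fin d)).measurable
    (MeasurableSet.univ_pi fun _ => measurableSet_Ico)

lemma volume_box (m : ℕ) (a : Fin d → ℝ) : volume (box (m : ℝ) a) = (m ^ d : ℕ) := by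
  rw [box_eq_preimage, (PiLp.volume_preserving_ofLp (Fin d)).measure_preimage
    (MeasurableSet.univ_pi fun _ => measurableSet_Ico).nullMeasurableSet, Real.volume_pi_Ico]
  simp

lemma setEnergy_box (m : ℝ) (a : Fin d → ℝ) : setEnergy s (box m a) =
    setEnergy s (box m (0 : Fin d → ℝ)) := by
  rw [← setEnergy_image (measurableSet_box m 0)
    (AffineIsometryEquiv.constVAdd ℝ (EuclideanSpace ℝ (Fin d)) (WithLp.toLp 2 a))]
  congr 1
  ext x
  simp only [Set.mem_image, AffineIsometryEquiv.coe_constVAdd, vadd_eq_add]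
  constructor
  · intro hx
    refine ⟨x - WithLp.toLp 2 a, fun i => ?_, by simp⟩
    have := hx i
    constructor <;> simp <;> linarith
  · rintro ⟨y, hy, rfl⟩ i
    have := hy i
    simp only [Pi.zero_apply, zero_add] at this
    constructor <;> simp <;> linarith

lemma dist_le_of_mem_box {m : ℝ} (hm : 0 ≤ m) {a : Fin d → ℝ} {x y : EuclideanSpace ℝ (Fin d)}
    (hx : x ∈ box m a) (hy : y ∈ box m a) : dist x y ≤ m * d := by
  rw [EuclideanSpace.dist_eq, Real.sqrt_le_iff]
  refine ⟨by positivity, ?_⟩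
  have h1 : ∀ i, dist (x i) (y i) ^ 2 ≤ m ^ 2 := fun i => by
    have := hx i
    have := hy i
    rw [Real.dist_eq, sq_abs]
    exact sq_le_sq' (by linarith) (by linarith)
  -- The bound `m * d` on the diameter is cruder than `m * √d`; any fixed multiple of `m` serves.
  have h2 : (d : ℝ) ≤ d ^ 2 := by exact_mod_cast Nat.le_self_pow two_ne_zero d
  calc ∑ i, dist (x i) (y i) ^ 2 ≤ ∑ _ : Fin d, m ^ 2 := Finset.sum_le_sum fun i _ => h1 i
    _ = d * m ^ 2 := by simp
    _ ≤ d ^ 2 * m ^ 2 := by gcongr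
    _ = _ := by ring

/-- The cubes of the grid with mesh `m` through the point `x₀`. -/
def gridBox {d : ℕ} (m : ℝ) (x₀ : EuclideanSpace ℝ (Fin d)) (k : Fin d → ℤ) :
    Set (EuclideanSpace ℝ (Fin d)) :=
  box m fun i => x₀ i + m * k i

lemma mem_gridBox_iff {m : ℝ} (hm : 0 < m) (x₀ x : EuclideanSpace ℝ (Fin d)) (k : Fin d → ℤ) :
    x ∈ gridBox m x₀ k ↔ ∀ i, ⌊(x i - x₀ i) / m⌋ = k i := by
  refine forall_congr' fun i => ?_
  rw [Int.floor_eq_iff, le_div_iff₀ hm, div_lt_iff₀ hm]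
  constructor <;> rintro ⟨h1, h2⟩ <;> constructor <;> linarith

lemma pairwise_disjoint_gridBox {m : ℝ} (hm : 0 < m) (x₀ : EuclideanSpace ℝ (Fin d)) :
    Pairwise (Function.onFun Disjoint (gridBox m x₀)) := by
  intro k l hkl
  refine Set.disjoint_left.2 fun x hk hl => hkl ?_
  rw [mem_gridBox_iff hm] at hk hl
  ext i
  rw [← hk i, hl i]

lemma exists_mem_gridBox {m : ℝ} (hm : 0 < m) (x₀ x : EuclideanSpace ℝ (Fin d)) :
    ∃ k, x ∈ gridBox m x₀ k :=
  ⟨fun i => ⌊(x i - x₀ i) / m⌋, (mem_gridBox_iff hm x₀ x _).2 fun _ => rfl⟩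

/-- The large cube is centred at the grid point `x₀` and has half-side `J * m`, so it is an exact
union of cells, and no cell straddles its boundary. -/
lemma gridBox_subset_box {m : ℕ} (hm : 0 < m) (J : ℕ) {x₀ x : EuclideanSpace ℝ (Fin d)}
    {k : Fin d → ℤ} (hx : x ∈ gridBox m x₀ k)
    (hx' : x ∈ box ((2 * J * m : ℕ) : ℝ) fun i => x₀ i - J * m) :
    gridBox m x₀ k ⊆ box ((2 * J * m : ℕ) : ℝ) fun i => x₀ i - J * m := by
  intro y hy i
  have hm' : (0 : ℝ) < m := by exact_mod_cast hm
  have h1 := hx i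
  have h2 := hx' i
  have h3 := hy i
  simp only at h1 h2 h3 ⊢
  push_cast at h1 h2 h3 ⊢
  have h4 : (-J : ℤ) ≤ k i := by
    have : (-J : ℝ) < k i + 1 := by
      by_contra! h
      nlinarith
    have : (-J : ℤ) < k i + 1 := by exact_mod_cast this
    omega
  have h5 : k i + 1 ≤ (J : ℤ) := by
    have : (k i : ℝ) < J := by
      by_contra! h
      nlinarith
    have : k i < (J : ℤ) := by exact_mod_cast this
    omega
  have h4' : (-J : ℝ) ≤ k i := by exact_mod_cast h4
  have h5' : (k i : ℝ) + 1 ≤ J := by exact_mod_cast h5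
  constructor <;> nlinarith

/-- The energy per volume of the cube with side `m`. -/
noncomputable def cubeEnergy (d : ℕ) (s : ℝ) (m : ℕ) : ℝ :=
  setEnergy s (box (m : ℝ) (0 : Fin d → ℝ)) / (m ^ d : ℕ)

lemma cubeEnergy_nonpos (hs : 0 < s) (hsd : s < d) (m : ℕ) : cubeEnergy d s m ≤ 0 :=
  div_nonpos_of_nonpos_of_nonneg (setEnergy_nonpos hs hsd (measurableSet_box _ _)
    (volume_box m 0)) (Nat.cast_nonneg _)

lemma setEnergy_le_of_gridBox (hs : 0 < s) (hsd : s < d) {m : ℕ} (hm : 0 < m)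
    (x₀ : EuclideanSpace ℝ (Fin d)) {A S : Set (EuclideanSpace ℝ (Fin d))}
    (hA : MeasurableSet A) {N : ℕ} (hN : volume A = N) (hS : volume S ≠ ∞)
    (hcov : ∀ x ∈ A, x ∉ S → ∀ k, x ∈ gridBox m x₀ k → gridBox m x₀ k ⊆ A) :
    setEnergy s A ≤ (volume.real A - volume.real S) * cubeEnergy d s m := by
  have hm' : (0 : ℝ) < m := by exact_mod_cast hm
  refine setEnergy_le_of_tiles hs hsd (T := gridBox (m : ℝ) x₀) (fun k => measurableSet_box _ _)
    (pairwise_disjoint_gridBox hm' x₀) (pow_pos hm d) (fun k => volume_box m _)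
    (fun k => setEnergy_box _ _) (setEnergy_nonpos hs hsd (measurableSet_box _ _)
    (volume_box m 0)) hA hN hS fun x hx hxS => ?_
  obtain ⟨k, hk⟩ := exists_mem_gridBox hm' x₀ x
  exact ⟨k, hk, hcov x hx hxS k hk⟩

end Box

/-! ### Connectedness, boundary regularity and diameter -/

section Boundary

variable {d : ℕ}

lemma exists_mem_frontier_dist_le {A : Set (EuclideanSpace ℝ (Fin d))}
    {x y : EuclideanSpace ℝ (Fin d)} (h : ¬ (x ∈ A ↔ y ∈ A)) :
    ∃ z ∈ frontier A, dist x z ≤ dist x y := by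
  have key : ∀ B : Set (EuclideanSpace ℝ (Fin d)), x ∈ B → y ∉ B →
      ∃ z ∈ frontier B, dist x z ≤ dist x y := by
    intro B hx hy
    obtain ⟨z, hz, hz'⟩ := exists_mem_frontier_infDist_compl_eq_dist hx
      (fun hB : B = Set.univ => hy (hB ▸ Set.mem_univ y))
    exact ⟨z, hz, hz' ▸ Metric.infDist_le_dist_of_mem hy⟩
  by_cases hx : x ∈ A
  · exact key A hx fun hy => h (by simp [hx, hy])
  · have := key Aᶜ hx fun hy => h (by simp_all)
    rwa [frontier_compl] at this

/-- By connectedness `Ω` has points at the distances `4 * r * j` from `x₀`. The `r`-ball about such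
a point lies in `Ω`, or else the frontier has a point within `r`, whose `r`-ball lies in the
boundary layer. Shifting centres by at most `r` leaves them `2 * r` apart, so the balls are
disjoint. -/
lemma card_mul_volume_ball_le {Ω : Set (EuclideanSpace ℝ (Fin d))} (hΩ : IsPreconnected Ω)
    {x₀ y : EuclideanSpace ℝ (Fin d)} (hx₀ : x₀ ∈ Ω) (hy : y ∈ Ω) {r : ℝ} (hr : 0 < r) (J : ℕ)
    (hJ : 4 * r * J ≤ dist y x₀) :
    J * volume (Metric.ball (0 : EuclideanSpace ℝ (Fin d)) r) ≤
      volume (Ω ∪ {x | Metric.infDist x (frontier Ω) ≤ r}) := by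
  have h1 : ∀ j : Fin J, ∃ x ∈ Ω, dist x x₀ = 4 * r * j := by
    intro j
    have hiv := hΩ.intermediate_value hx₀ hy
      (continuous_id.dist (continuous_const (y := x₀))).continuousOn
    have hj : (j : ℝ) ≤ J := by exact_mod_cast j.2.le
    have : 4 * r * (j : ℝ) ∈ Set.Icc (dist (id x₀) x₀) (dist (id y) x₀) := by
      constructor
      · simp; positivity
      · simp only [id]; nlinarith
    exact hiv this
  have h2 : ∀ j : Fin J, ∃ p, (∃ x, dist x x₀ = 4 * r * j ∧ dist x p ≤ r) ∧
      Metric.ball p r ⊆ Ω ∪ {x | Metric.infDist x (frontier Ω) ≤ r} := by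
    intro j
    obtain ⟨x, hx, hxj⟩ := h1 j
    by_cases hb : Metric.ball x r ⊆ Ω
    · exact ⟨x, ⟨x, hxj, by simp [hr.le]⟩, hb.trans Set.subset_union_left⟩
    · obtain ⟨w, hw, hwΩ⟩ := Set.not_subset.1 hb
      obtain ⟨z, hz, hxz⟩ := exists_mem_frontier_dist_le (A := Ω) (x := x) (y := w) (by simp [hx, hwΩ])
      rw [Metric.mem_ball, dist_comm] at hw
      refine ⟨z, ⟨x, hxj, hxz.trans hw.le⟩, fun v hv => Or.inr ?_⟩
      exact (Metric.infDist_le_dist_of_mem hz).trans (Metric.mem_ball.1 hv).le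
  choose p hp hpU using h2
  have hdisj : Pairwise (Function.onFun Disjoint fun j => Metric.ball (p j) r) := by
    intro i j hij
    refine Metric.ball_disjoint_ball ?_
    obtain ⟨x, hx, hxp⟩ := hp i
    obtain ⟨x', hx', hxp'⟩ := hp j
    have h3 : 4 * r ≤ dist x x' := by
      have h4 : (1 : ℝ) ≤ |(i : ℝ) - j| := by
        have : (1 : ℤ) ≤ |(i : ℤ) - j| := Int.one_le_abs (by
          have : (i : ℕ) ≠ j := fun h => hij (Fin.ext h)
          omega)
        exact_mod_cast this
      have h5 := abs_dist_sub_le x x' x₀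
      rw [hx, hx', ← mul_sub, abs_mul, abs_of_pos (by positivity : 0 < 4 * r)] at h5
      nlinarith
    have h6 := dist_triangle4 x (p i) (p j) x'
    rw [dist_comm (p j)] at h6
    linarith
  calc _ = ∑ j : Fin J, volume (Metric.ball (p j) r) := by
        simp [Measure.addHaar_ball_center]
    _ = volume (⋃ j, Metric.ball (p j) r) := by
        rw [measure_iUnion hdisj fun j => Metric.isOpen_ball.measurableSet, tsum_fintype]
    _ ≤ _ := measure_mono (Set.iUnion_subset hpU)

/-- Connected sets with a regular boundary have a diameter comparable to the length scale given by
their volume. -/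
lemma exists_dist_lt_of_hasRegularBoundary (hd : 0 < d) {t₀ t : ℝ} (ht : 0 < t) (htt : t < t₀)
    (η : ℝ → ℝ) (hη : 0 ≤ η t) :
    ∃ C : ℝ, 0 < C ∧ ∀ Ω : Set (EuclideanSpace ℝ (Fin d)), IsPreconnected Ω →
      HasRegularBoundary t₀ η Ω → 0 < volume.real Ω → ∀ x₀ ∈ Ω, ∀ y ∈ Ω,
        dist y x₀ < C * volume.real Ω ^ (1 / (d : ℝ)) := by
  set c := volume.real (Metric.ball (0 : EuclideanSpace ℝ (Fin d)) 1) with hc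
  have hct : volume (Metric.ball (0 : EuclideanSpace ℝ (Fin d)) 1) ≠ ∞ := measure_ball_lt_top.ne
  have hc0 : 0 < c := ENNReal.toReal_pos (Metric.measure_ball_pos _ _ one_pos).ne' hct
  -- With this `J`, the `J` balls of radius `l * t` have total volume above `V * (1 + η t)`, which
  -- bounds the volume of `Ω` together with its boundary layer. So the diameter cannot reach `4 * (l
  -- * t) * J`.
  set J : ℕ := ⌊(1 + η t) / (c * t ^ d)⌋₊ + 1 with hJ
  have hJ' : (1 + η t) / (c * t ^ d) < J := by rw [hJ]; exact_mod_cast Nat.lt_floor_add_one _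
  refine ⟨4 * t * J, by positivity, fun Ω hΩ hreg hV x₀ hx₀ y hy => ?_⟩
  set V := volume.real Ω with hVdef
  set l := V ^ (1 / (d : ℝ)) with hl
  have hl0 : 0 < l := by positivity
  have hld : l ^ d = V := by
    rw [hl, one_div, Real.rpow_inv_natCast_pow hV.le hd.ne']
  by_contra! hcon
  have h1 := card_mul_volume_ball_le hΩ hx₀ hy (r := l * t) (by positivity) J (by linarith)
  have h2 := hreg t ⟨ht.le, htt⟩
  have hVt : volume Ω ≠ ∞ := fun h => by simp [hVdef, measureReal_def, h] at hV
  have h3 : volume (Ω ∪ {x | Metric.infDist x (frontier Ω) ≤ l * t}) ≤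
      ENNReal.ofReal (V + V * η t) := by
    rw [ENNReal.ofReal_add hV.le (by positivity)]
    refine (measure_union_le _ _).trans (add_le_add ?_ h2)
    rw [hVdef, measureReal_def, ENNReal.ofReal_toReal hVt]
  rw [Measure.addHaar_ball_of_pos _ _ (by positivity), finrank_euclideanSpace_fin] at h1
  have h4 := ENNReal.toReal_mono ENNReal.ofReal_ne_top (h1.trans h3)
  rw [ENNReal.toReal_ofReal (by positivity), ENNReal.toReal_mul, ENNReal.toReal_mul,
    ENNReal.toReal_natCast, ENNReal.toReal_ofReal (by positivity), mul_pow, hld,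
    ← measureReal_def, ← hc] at h4
  rw [div_lt_iff₀ (by positivity)] at hJ'
  have h5 := mul_lt_mul_of_pos_left hJ' hV
  linarith

end Boundary

/-! ### Existence of the thermodynamic limit -/

section ThermodynamicLimit

variable {d : ℕ} {s : ℝ}

/-- The infimum of the energies per volume of cubes of integer side. -/
noncomputable def cubeLimit (d : ℕ) (s : ℝ) : ℝ := ⨅ m : ℕ, cubeEnergy d s (m + 1)

lemma bddBelow_cubeEnergy (hs : 0 < s) (hsd : s < d) :
    BddBelow (Set.range fun m : ℕ => cubeEnergy d s (m + 1)) := by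
  obtain ⟨κ, hκ⟩ := exists_neg_le_setEnergy hs hsd
  refine ⟨-κ, ?_⟩
  rintro _ ⟨m, rfl⟩
  have h := hκ _ (measurableSet_box _ _) _ (volume_box (m + 1) (0 : Fin d → ℝ))
  simp only [cubeEnergy]
  rw [le_div_iff₀ (by positivity)]
  linarith

lemma cubeLimit_le (hs : 0 < s) (hsd : s < d) {m : ℕ} (hm : 0 < m) :
    cubeLimit d s ≤ cubeEnergy d s m := by
  obtain ⟨k, rfl⟩ := Nat.exists_eq_succ_of_ne_zero hm.ne'
  exact ciInf_le (bddBelow_cubeEnergy hs hsd) k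

lemma exists_cubeEnergy_lt {ε : ℝ} (hε : 0 < ε) :
    ∃ m : ℕ, 0 < m ∧ cubeEnergy d s m < cubeLimit d s + ε := by
  obtain ⟨m, hm⟩ := exists_lt_of_ciInf_lt (show cubeLimit d s < cubeLimit d s + ε by linarith)
  exact ⟨m + 1, m.succ_pos, hm⟩

lemma mem_iff_of_notMem_boundary {m : ℕ} {Ω : Set (EuclideanSpace ℝ (Fin d))}
    {x₀ x y : EuclideanSpace ℝ (Fin d)} {k : Fin d → ℤ} (hx : x ∈ gridBox m x₀ k)
    (hxS : x ∉ {x | Metric.infDist x (frontier Ω) ≤ (m : ℝ) * d}) (hy : y ∈ gridBox m x₀ k) :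
    x ∈ Ω ↔ y ∈ Ω := by
  by_contra h
  obtain ⟨z, hz, hxz⟩ := exists_mem_frontier_dist_le h
  exact hxS ((Metric.infDist_le_dist_of_mem hz).trans
    (hxz.trans (dist_le_of_mem_box (Nat.cast_nonneg _) hx hy)))

lemma setEnergy_le_cubeEnergy (hs : 0 < s) (hsd : s < d) {m : ℕ} (hm : 0 < m)
    {Ω : Set (EuclideanSpace ℝ (Fin d))} (hΩ : MeasurableSet Ω) {N : ℕ} (hN : volume Ω = N)
    (hS : volume {x | Metric.infDist x (frontier Ω) ≤ (m : ℝ) * d} ≠ ∞) :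
    setEnergy s Ω ≤ (volume.real Ω -
      volume.real {x | Metric.infDist x (frontier Ω) ≤ (m : ℝ) * d}) * cubeEnergy d s m :=
  setEnergy_le_of_gridBox hs hsd hm 0 hΩ hN hS fun _ hx hxS _ hk _ hy =>
    (mem_iff_of_notMem_boundary hk hxS hy).1 hx

lemma subset_box_of_dist_lt {Ω : Set (EuclideanSpace ℝ (Fin d))} {m J : ℕ}
    {x₀ : EuclideanSpace ℝ (Fin d)} (hball : ∀ x ∈ Ω, dist x x₀ < J * m) :
    Ω ⊆ box ((2 * J * m : ℕ) : ℝ) fun i => x₀ i - J * m := by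
  intro x hx i
  have h1 := hball x hx
  have h2 : |x i - x₀ i| ≤ dist x x₀ := by
    rw [dist_eq_norm]
    have := PiLp.norm_apply_le (x - x₀) i
    simpa using this
  have h3 := abs_lt.1 (h2.trans_lt h1)
  push_cast
  constructor <;> linarith

/-- Subadditivity for the enclosing cube, split into `Ω` and its complement there. A grid cell
meeting the complement away from the frontier of `Ω` misses `Ω` altogether, so the complement can be
filled with cells. -/
lemma cubeLimit_le_setEnergy (hs : 0 < s) (hsd : s < d) {m : ℕ} (hm : 0 < m)
    {Ω : Set (EuclideanSpace ℝ (Fin d))} (hΩ : MeasurableSet Ω) {N : ℕ} (hN : volume Ω = N)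
    (hS : volume {x | Metric.infDist x (frontier Ω) ≤ (m : ℝ) * d} ≠ ∞)
    {x₀ : EuclideanSpace ℝ (Fin d)} {J : ℕ} (hJ : 0 < J) (hball : ∀ x ∈ Ω, dist x x₀ < J * m) :
    cubeLimit d s * ((2 * J * m) ^ d : ℕ) ≤ setEnergy s Ω + (((2 * J * m) ^ d : ℕ) -
      volume.real Ω - volume.real {x | Metric.infDist x (frontier Ω) ≤ (m : ℝ) * d}) *
        cubeEnergy d s m := by
  set C : Set (EuclideanSpace ℝ (Fin d)) :=
    box ((2 * J * m : ℕ) : ℝ) fun i => x₀ i - J * m with hC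
  have hCm : MeasurableSet C := measurableSet_box _ _
  have hCv : volume C = ((2 * J * m) ^ d : ℕ) := volume_box _ _
  have hΩC : Ω ⊆ C := subset_box_of_dist_lt hball
  have hdv : volume (C \ Ω) = ((2 * J * m) ^ d - N : ℕ) := by
    rw [measure_sdiff hΩC hΩ.nullMeasurableSet (by simp [hN]), hCv, hN, ENNReal.natCast_sub]
  have hdr : volume.real (C \ Ω) = ((2 * J * m) ^ d : ℕ) - volume.real Ω := by
    rw [measureReal_sdiff hΩC hΩ (hCv ▸ ENNReal.natCast_ne_top _), measureReal_def, hCv, ENNReal.toReal_natCast]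
  have h1 : setEnergy s C ≤ setEnergy s Ω + setEnergy s (C \ Ω) := by
    have := setEnergy_union_le hs hsd hΩ (hCm.diff hΩ) Set.disjoint_sdiff_right hN hdv
    rwa [Set.union_sdiff_cancel hΩC] at this
  have h2 := setEnergy_le_of_gridBox hs hsd hm x₀ (hCm.diff hΩ) hdv hS
    fun x hx hxS k hk y hy => ⟨gridBox_subset_box hm J hk hx.1 hy,
      fun hyΩ => hx.2 ((mem_iff_of_notMem_boundary hk hxS hy).2 hyΩ)⟩
  have h3 : cubeLimit d s * ((2 * J * m) ^ d : ℕ) ≤ setEnergy s C := by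
    have h4 : 0 < 2 * J * m := by positivity
    have := cubeLimit_le hs hsd h4
    rwa [cubeEnergy, le_div_iff₀ (by exact_mod_cast pow_pos h4 d), ← setEnergy_box] at this
  rw [hdr] at h2
  linarith

/-- A neighbourhood of fixed width of the boundary is negligible along admissible sequences. -/
lemma exists_tendsto_boundary {Ω : ℕ → Set (EuclideanSpace ℝ (Fin d))} (hd : 0 < d)
    (hΩ : IsThermodynamicSequence Ω) {D : ℝ} (hD : 0 ≤ D) :
    ∃ δ : ℕ → ℝ, Tendsto δ atTop (𝓝 0) ∧ ∀ᶠ n in atTop,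
      volume {x | Metric.infDist x (frontier (Ω n)) ≤ D} ≠ ∞ ∧
      volume.real {x | Metric.infDist x (frontier (Ω n)) ≤ D} ≤ volume.real (Ω n) * δ n := by
  obtain ⟨t₀, ht₀, η, hηc, hη, hη0, hreg⟩ := hΩ.regular
  have hd' : (0 : ℝ) < d := by exact_mod_cast hd
  have hl : Tendsto (fun n => volume.real (Ω n) ^ (1 / (d : ℝ))) atTop atTop :=
    (tendsto_rpow_atTop (by positivity)).comp hΩ.volume_tendsto
  have ht : Tendsto (fun n => D / volume.real (Ω n) ^ (1 / (d : ℝ))) atTop (𝓝 0) :=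
    hl.const_div_atTop D
  have hev : ∀ᶠ n in atTop, D / volume.real (Ω n) ^ (1 / (d : ℝ)) ∈ Set.Ico 0 t₀ := by
    filter_upwards [ht.eventually_lt_const ht₀] with n hn
    exact ⟨by positivity, hn⟩
  -- The argument of `η` is the rescaled width, for which the layer has width exactly `D`; it tends
  -- to `0`, where `η` is continuous and vanishes.
  refine ⟨fun n => η (D / volume.real (Ω n) ^ (1 / (d : ℝ))), ?_, ?_⟩
  · have h1 := hηc 0 ⟨le_rfl, ht₀⟩
    rw [ContinuousWithinAt, hη0] at h1
    exact h1.comp (tendsto_nhdsWithin_iff.2 ⟨ht, hev⟩)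
  · filter_upwards [hev, hl.eventually_gt_atTop 0] with n hn hln
    have h2 := hreg n _ hn
    rw [mul_div_cancel₀ _ hln.ne'] at h2
    refine ⟨ne_top_of_le_ne_top ENNReal.ofReal_ne_top h2, ?_⟩
    have h3 := ENNReal.toReal_mono ENNReal.ofReal_ne_top h2
    rwa [ENNReal.toReal_ofReal (mul_nonneg measureReal_nonneg (hη _ hn))] at h3

/-- The thermodynamic limit exists. -/
theorem isThermodynamicLimit_cubeLimit (hs : 0 < s) (hsd : s < d) :
    IsThermodynamicLimit d s (cubeLimit d s) := by
  intro Ω hΩ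
  have hd : 0 < d := by
    have := hs.trans hsd
    exact_mod_cast this
  obtain ⟨C, hC, hdiam⟩ : ∃ C : ℝ, 0 < C ∧ ∀ n, 0 < volume.real (Ω n) →
      ∀ x₀ ∈ Ω n, ∀ y ∈ Ω n, dist y x₀ < C * volume.real (Ω n) ^ (1 / (d : ℝ)) := by
    obtain ⟨t₀, ht₀, η, -, hη, -, hreg⟩ := hΩ.regular
    obtain ⟨C, hC, h⟩ := exists_dist_lt_of_hasRegularBoundary hd (half_pos ht₀)
      (half_lt_self ht₀) η (hη _ ⟨by positivity, half_lt_self ht₀⟩)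
    exact ⟨C, hC, fun n => h _ (hΩ.isConnected n).isPreconnected (hreg n)⟩
  -- `K` bounds the volume ratio of the enclosing cube to the domain: its side `2 * J * m` is at
  -- most `2 * (C * l + m)`, and eventually `m ≤ l`.
  set K : ℝ := (2 * (C + 1)) ^ d with hK
  have hK0 : 0 < K := by positivity
  rw [Metric.tendsto_atTop']
  intro ε hε
  -- The excess of the small cubes over the infimum is paid on up to `K` times the volume; this uses
  -- less than `ε / 2`, and the boundary layer uses the other half.
  set ε₁ := ε / (2 * (K + 1)) with hε₁
  have hε₁0 : 0 < ε₁ := by positivity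
  obtain ⟨m, hm, hlt⟩ := exists_cubeEnergy_lt (d := d) (s := s) hε₁0
  set a := cubeEnergy d s m with ha
  set e := cubeLimit d s with he
  have ha0 : a ≤ 0 := cubeEnergy_nonpos hs hsd m
  have hea : e ≤ a := cubeLimit_le hs hsd hm
  obtain ⟨δ, hδ, hev⟩ := exists_tendsto_boundary hd hΩ (D := m * d) (by positivity)
  have hl : Tendsto (fun n => volume.real (Ω n) ^ (1 / (d : ℝ))) atTop atTop :=
    (tendsto_rpow_atTop (by positivity)).comp hΩ.volume_tendsto
  have hδa : ∀ᶠ n in atTop, δ n * (-a) < ε / 2 := by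
    have := hδ.mul_const (-a)
    rw [zero_mul] at this
    exact this.eventually_lt_const (half_pos hε)
  obtain ⟨n₀, hn₀⟩ := eventually_atTop.1 (hev.and (hδa.and
    ((hl.eventually_ge_atTop (m : ℝ)).and (hΩ.volume_tendsto.eventually_gt_atTop 0))))
  refine ⟨n₀, fun n hn => ?_⟩
  obtain ⟨⟨hSt, hSδ⟩, hδn, hlm, hV⟩ := hn₀ n hn.le
  obtain ⟨N, hN⟩ := hΩ.volume_integer n
  obtain ⟨x₀, hx₀⟩ := (hΩ.isConnected n).nonempty
  have hΩm := (hΩ.isOpen n).measurableSet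
  have hup := setEnergy_le_cubeEnergy hs hsd hm hΩm hN hSt
  set V := volume.real (Ω n) with hVdef
  set l := V ^ (1 / (d : ℝ)) with hldef
  set S := volume.real {x | Metric.infDist x (frontier (Ω n)) ≤ (m : ℝ) * d} with hSdef
  set E := setEnergy s (Ω n) with hE
  have hm' : (0 : ℝ) < m := by exact_mod_cast hm
  have hl0 : 0 < l := hm'.trans_le hlm
  have hld : l ^ d = V := by rw [hldef, one_div, Real.rpow_inv_natCast_pow hV.le hd.ne']
  set J := ⌈C * l / m⌉₊ with hJ
  have hJ0 : 0 < J := Nat.ceil_pos.2 (by positivity)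
  have hJ1 : C * l ≤ J * m := (div_le_iff₀ hm').1 (Nat.le_ceil _)
  have hJ2 : J * m < C * l + m := by
    have := Nat.ceil_lt_add_one (show 0 ≤ C * l / m by positivity)
    calc (J : ℝ) * m < (C * l / m + 1) * m := by gcongr
      _ = _ := by field_simp
  have hlow := cubeLimit_le_setEnergy hs hsd hm hΩm hN hSt hJ0
    fun x hx => (hdiam n hV x₀ hx₀ x hx).trans_le hJ1
  rw [← he, ← ha, ← hVdef, ← hSdef, ← hE] at hlow
  set L : ℝ := (((2 * J * m) ^ d : ℕ) : ℝ) with hL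
  have hLK : L ≤ K * V := by
    rw [hL, hK, ← hld, ← mul_pow]
    push_cast
    refine pow_le_pow_left₀ (by positivity) ?_ d
    nlinarith
  have hLV : V ≤ L := by
    have hsub := subset_box_of_dist_lt fun x hx => (hdiam n hV x₀ hx₀ x hx).trans_le hJ1
    have hv := volume_box (2 * J * m) fun i => x₀ i - J * m
    have := measureReal_mono (μ := volume) hsub (hv ▸ ENNReal.natCast_ne_top _)
    rwa [measureReal_def (s := box _ _), hv, ENNReal.toReal_natCast] at this
  have h1 : E ≤ V * (a + δ n * (-a)) := by nlinarith
  have h2 : V * (e - ε₁ * K - δ n * (-a)) ≤ E := by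
    have h3 : (a - e) * (L - V) ≤ ε₁ * (K * V) :=
      mul_le_mul (by linarith) (by linarith) (by linarith) hε₁0.le
    nlinarith
  have hε₂ : ε₁ * (K + 1) = ε / 2 := by rw [hε₁]; field_simp
  rw [Real.dist_eq, abs_lt]
  constructor
  · rw [lt_sub_iff_add_lt, lt_div_iff₀ hV]
    nlinarith
  · rw [sub_lt_iff_lt_add, div_lt_iff₀ hV]
    nlinarith

end ThermodynamicLimit

/-! ### Balls as test domains, and tilings -/

section Tiling

variable {d : ℕ} {s : ℝ}

/-- The volume of the unit ball. -/
noncomputable def unitBallVolume (d : ℕ) : ℝ :=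
  volume.real (Metric.ball (0 : EuclideanSpace ℝ (Fin d)) 1)

lemma unitBallVolume_pos : 0 < unitBallVolume d :=
  ENNReal.toReal_pos (Metric.measure_ball_pos _ _ one_pos).ne' measure_ball_lt_top.ne

lemma volume_ball_eq {r : ℝ} (hr : 0 < r) :
    volume (Metric.ball (0 : EuclideanSpace ℝ (Fin d)) r) =
      ENNReal.ofReal (unitBallVolume d * r ^ d) := by
  rw [Measure.addHaar_ball_of_pos _ _ hr, finrank_euclideanSpace_fin, mul_comm,
    ENNReal.ofReal_mul unitBallVolume_pos.le, unitBallVolume, measureReal_def,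
    ENNReal.ofReal_toReal measure_ball_lt_top.ne]

lemma volume_real_ball {r : ℝ} (hr : 0 < r) :
    volume.real (Metric.ball (0 : EuclideanSpace ℝ (Fin d)) r) = unitBallVolume d * r ^ d := by
  have := unitBallVolume_pos (d := d)
  rw [measureReal_def, volume_ball_eq hr, ENNReal.toReal_ofReal (by positivity)]

/-- The radius of the ball with volume `n + 1`. -/
noncomputable def ballRadius (d n : ℕ) : ℝ := ((n + 1) / unitBallVolume d) ^ (1 / (d : ℝ))

lemma ballRadius_pos (n : ℕ) : 0 < ballRadius d n := by
  have := unitBallVolume_pos (d := d)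
  unfold ballRadius
  positivity

lemma unitBallVolume_mul_ballRadius (hd : 0 < d) (n : ℕ) :
    unitBallVolume d * ballRadius d n ^ d = n + 1 := by
  have := unitBallVolume_pos (d := d)
  rw [ballRadius, one_div, Real.rpow_inv_natCast_pow (by positivity) hd.ne']
  field_simp

lemma tendsto_ballRadius (hd : 0 < d) : Tendsto (ballRadius d) atTop atTop := by
  have hd' : (0 : ℝ) < d := by exact_mod_cast hd
  refine (tendsto_rpow_atTop (by positivity)).comp ?_
  exact (tendsto_natCast_atTop_atTop.atTop_add tendsto_const_nhds).atTop_div_const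
    unitBallVolume_pos

lemma volume_ball_ballRadius (hd : 0 < d) (n : ℕ) :
    volume (Metric.ball (0 : EuclideanSpace ℝ (Fin d)) (ballRadius d n)) = (n + 1 : ℕ) := by
  rw [volume_ball_eq (ballRadius_pos n), unitBallVolume_mul_ballRadius hd]
  exact_mod_cast ENNReal.ofReal_natCast (n + 1)

lemma isThermodynamicSequence_ball (hd : 0 < d) :
    IsThermodynamicSequence
      fun n => Metric.ball (0 : EuclideanSpace ℝ (Fin d)) (ballRadius d n) where
  isOpen n := Metric.isOpen_ball
  isConnected n :=
    ⟨Metric.nonempty_ball.2 (ballRadius_pos n), (convex_ball _ _).isPreconnected⟩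
  isBounded n := Metric.isBounded_ball
  volume_integer n := ⟨n + 1, volume_ball_ballRadius hd n⟩
  volume_tendsto := by
    simp only [measureReal_def, volume_ball_ballRadius hd, ENNReal.toReal_natCast]
    exact tendsto_natCast_atTop_atTop.comp (tendsto_add_atTop_nat 1)
  regular := by
    have hc := unitBallVolume_pos (d := d)
    set c := unitBallVolume d with hcdef
    have hnt : Nontrivial (EuclideanSpace ℝ (Fin d)) := by
      have : Nonempty (Fin d) := ⟨⟨0, hd⟩⟩
      infer_instance
    set q := c ^ (1 / (d : ℝ)) with hq
    have hq0 : 0 < q := by positivity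
    have htau : ∀ t ∈ Set.Ico 0 q⁻¹, 0 ≤ q * t ∧ q * t < 1 := fun t ht =>
      ⟨mul_nonneg hq0.le ht.1, by
        have := mul_lt_mul_of_pos_left ht.2 hq0
        rwa [mul_inv_cancel₀ hq0.ne'] at this⟩
    -- The length `|Ω|^{1/d}` of a ball of radius `R` is `q * R`, so the layer lies in the shell
    -- between radii `R * (1 - q * t)` and `R * (1 + q * t)`. The restriction `t < q⁻¹` keeps the
    -- inner radius positive.
    refine ⟨q⁻¹, by positivity, fun t => (1 + q * t) ^ d - (1 - q * t) ^ d, by fun_prop,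
      fun t ht => ?_, by simp, fun n t ht => ?_⟩
    · obtain ⟨h1, h2⟩ := htau t ht
      exact sub_nonneg.2 (pow_le_pow_left₀ (by linarith) (by linarith) d)
    obtain ⟨h1, h2⟩ := htau t ht
    set R := ballRadius d n with hR
    have hR0 : 0 < R := ballRadius_pos n
    have hV : volume.real (Metric.ball (0 : EuclideanSpace ℝ (Fin d)) R) = c * R ^ d :=
      volume_real_ball hR0
    have hl : (c * R ^ d) ^ (1 / (d : ℝ)) = q * R := by
      rw [Real.mul_rpow hc.le (by positivity), one_div, Real.pow_rpow_inv_natCast hR0.le hd.ne',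
        hq, one_div]
    rw [hV, hl, frontier_ball _ hR0.ne']
    have hsub : {x : EuclideanSpace ℝ (Fin d) | Metric.infDist x (Metric.sphere 0 R) ≤ q * R * t} ⊆
        Metric.closedBall 0 (R * (1 + q * t)) \ Metric.ball 0 (R * (1 - q * t)) := by
      intro x hx
      obtain ⟨y, hy, hxy⟩ := (isCompact_sphere (0 : EuclideanSpace ℝ (Fin d)) R).exists_infDist_eq_dist
        (NormedSpace.sphere_nonempty.2 hR0.le) x
      rw [Set.mem_ofPred_eq, hxy] at hx
      rw [mem_sphere_zero_iff_norm] at hy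
      rw [dist_eq_norm] at hx
      have h3 := abs_norm_sub_norm_le x y
      rw [hy] at h3
      have h4 := abs_le.1 (h3.trans hx)
      simp only [Set.mem_sdiff, mem_closedBall_zero_iff, mem_ball_zero_iff, not_lt]
      constructor <;> nlinarith
    refine (measure_mono hsub).trans ?_
    have hlt : 0 < R * (1 - q * t) := mul_pos hR0 (by linarith)
    have hle : R * (1 - q * t) ≤ R * (1 + q * t) := by nlinarith
    rw [measure_sdiff ((Metric.ball_subset_ball hle).trans Metric.ball_subset_closedBall)
      Metric.isOpen_ball.measurableSet.nullMeasurableSet measure_ball_lt_top.ne,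
      Measure.addHaar_closedBall_eq_addHaar_ball, volume_ball_eq hlt,
      volume_ball_eq (hlt.trans_le hle), ← ENNReal.ofReal_sub _ (by positivity)]
    refine ENNReal.ofReal_le_ofReal (le_of_eq ?_)
    rw [mul_pow, mul_pow]
    ring

/-- The lower bound for sets that tile the space. -/
theorem le_setEnergy_div_of_generatesTiling (hs : 0 < s) (hsd : s < d) {e : ℝ}
    (he : IsThermodynamicLimit d s e) {Ω : Set (EuclideanSpace ℝ (Fin d))}
    (hΩm : MeasurableSet Ω) (hΩc : Convex ℝ Ω) (hΩb : Bornology.IsBounded Ω)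
    (hΩi : (interior Ω).Nonempty) (hΩt : GeneratesTiling Ω) {N : ℕ} (hN : volume Ω = N) :
    e ≤ setEnergy s Ω / volume.real Ω := by
  have hd : 0 < d := by
    have := hs.trans hsd
    exact_mod_cast this
  obtain ⟨G, hGU, hGd⟩ := hΩt
  -- The copies of the interior are disjoint nonempty open sets in a separable space. Countability
  -- is needed for the union of all tile boundaries to be null.
  have hG : G.Countable := by
    refine Set.PairwiseDisjoint.countable_of_isOpen hGd
      (fun g _ => g.toHomeomorph.isOpenMap _ isOpen_interior) fun g _ => hΩi.image _
  obtain ⟨D, hD⟩ := Metric.isBounded_iff.1 hΩb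
  have hD0 : 0 ≤ D := by
    obtain ⟨x, hx⟩ := hΩi
    simpa using hD (interior_subset hx) (interior_subset hx)
  have hfr : volume (frontier Ω) = 0 := hΩc.addHaar_frontier volume
  have hae : (interior Ω : Set _) =ᵐ[volume] Ω := interior_ae_eq_of_null_frontier hfr
  have hvi : volume (interior Ω) = N := by rw [measure_congr hae, hN]
  have hei : setEnergy s (interior Ω) = setEnergy s Ω :=
    setEnergy_congr_ae isOpen_interior.measurableSet hΩm hae
  have hN0 : 0 < N := by
    have := isOpen_interior.measure_pos volume hΩi
    rw [hvi] at this
    exact_mod_cast this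
  have hmeas (g : EuclideanSpace ℝ (Fin d) ≃ᵃⁱ[ℝ] EuclideanSpace ℝ (Fin d))
      (A : Set (EuclideanSpace ℝ (Fin d))) : volume (g '' A) = volume A := by
    have h := congrArg (fun μ => μ Set.univ) (map_restrict_isometry g A)
    simpa [Measure.map_apply (measurable_isometry g)] using h.symm
  have hnull : volume (⋃ g ∈ G, g '' frontier Ω) = 0 := by
    rw [measure_biUnion_null_iff hG]
    intro g _
    rw [hmeas, hfr]
  have hc := unitBallVolume_pos (d := d)
  have hNr : volume.real Ω = N := by simp [measureReal_def, hN]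
  rw [hNr]
  have hneg : setEnergy s Ω ≤ 0 := setEnergy_nonpos hs hsd hΩm hN
  have hlim : Tendsto (fun n => ((ballRadius d n - D) / ballRadius d n) ^ d * (setEnergy s Ω / N))
      atTop (𝓝 (setEnergy s Ω / N)) := by
    have h1 : Tendsto (fun n => 1 - D / ballRadius d n) atTop (𝓝 (1 - 0)) :=
      tendsto_const_nhds.sub ((tendsto_ballRadius hd).const_div_atTop D)
    have h2 := (h1.pow d).mul_const (setEnergy s Ω / N)
    simp only [sub_zero, one_pow, one_mul] at h2
    refine h2.congr fun n => ?_
    have := (ballRadius_pos (d := d) n).ne'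
    rw [sub_div, div_self this]
  refine le_of_tendsto_of_tendsto (he _ (isThermodynamicSequence_ball hd)) hlim ?_
  filter_upwards [(tendsto_ballRadius hd).eventually_gt_atTop D] with n hn
  set R := ballRadius d n with hR
  have hR0 : 0 < R := ballRadius_pos n
  -- Outside `S` a point is interior to some tile and at least `D` away from the sphere. As `D`
  -- bounds the diameter of a tile, that tile stays in the ball.
  set S : Set (EuclideanSpace ℝ (Fin d)) :=
    (Metric.ball 0 R \ Metric.ball 0 (R - D)) ∪ ⋃ g ∈ G, g '' frontier Ω with hS
  have hSv : volume S ≤ volume (Metric.ball (0 : EuclideanSpace ℝ (Fin d)) R \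
      Metric.ball 0 (R - D)) := (measure_union_le _ _).trans_eq (by rw [hnull, add_zero])
  have hdt : volume (Metric.ball (0 : EuclideanSpace ℝ (Fin d)) R \
      Metric.ball 0 (R - D)) ≠ ∞ :=
    ne_top_of_le_ne_top measure_ball_lt_top.ne (measure_mono Set.sdiff_subset)
  have hSr : volume.real S ≤ unitBallVolume d * R ^ d - unitBallVolume d * (R - D) ^ d := by
    refine (ENNReal.toReal_mono hdt hSv).trans_eq ?_
    rw [← measureReal_def, measureReal_sdiff (Metric.ball_subset_ball (by linarith))
      Metric.isOpen_ball.measurableSet measure_ball_lt_top.ne, volume_real_ball hR0,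
      volume_real_ball (by linarith)]
  have key := setEnergy_le_of_tiles hs hsd (T := fun g : G => g.1 '' interior Ω)
    (fun g => (g.1.toHomeomorph.isOpenMap _ isOpen_interior).measurableSet)
    (fun g h hgh => hGd g.2 h.2 fun heq => hgh (Subtype.ext heq)) hN0
    (fun g => (hmeas _ _).trans hvi)
    (fun g => (setEnergy_image isOpen_interior.measurableSet g.1).trans hei) hneg
    (Metric.isOpen_ball.measurableSet) (volume_ball_ballRadius hd n)
    (ne_top_of_le_ne_top hdt hSv) (fun x hx hxS => by
      have hx1 : x ∈ Metric.ball (0 : EuclideanSpace ℝ (Fin d)) (R - D) := by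
        by_contra h
        exact hxS (Or.inl ⟨hx, h⟩)
      have hxU : x ∈ ⋃ g ∈ G, g '' Ω := hGU ▸ Set.mem_univ x
      simp only [Set.mem_iUnion₂] at hxU
      obtain ⟨g, hg, w, hw, rfl⟩ := hxU
      have hwi : w ∈ interior Ω := by
        by_contra h
        exact hxS (Or.inr (Set.mem_biUnion hg ⟨w, ⟨subset_closure hw, h⟩, rfl⟩))
      refine ⟨⟨g, hg⟩, ⟨w, hwi, rfl⟩, ?_⟩
      rintro _ ⟨v, hv, rfl⟩
      have h1 := hD (interior_subset hv) hw
      rw [← g.isometry.dist_eq] at h1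
      have h2 := dist_triangle (g v) (g w) 0
      rw [Metric.mem_ball] at hx1 ⊢
      linarith)
  rw [volume_real_ball hR0] at key ⊢
  rw [div_le_iff₀ (by positivity)]
  have hq : setEnergy s Ω / N ≤ 0 := div_nonpos_of_nonpos_of_nonneg hneg (Nat.cast_nonneg _)
  calc _ ≤ (unitBallVolume d * R ^ d - volume.real S) * (setEnergy s Ω / N) := key
    _ ≤ (unitBallVolume d * (R - D) ^ d) * (setEnergy s Ω / N) :=
        mul_le_mul_of_nonpos_right (by linarith) hq
    _ = _ := by rw [div_pow]; field_simp

end Tiling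

/-! ### Parallelepipeds tile by lattice translations -/

section Parallelepiped

variable {d : ℕ}

/-- A parallelepiped is the preimage of the unit cube under suitable affine coordinates. -/
lemma exists_homeomorph_of_isParallelepiped {Ω : Set (EuclideanSpace ℝ (Fin d))}
    (hΩ : IsParallelepiped Ω) :
    ∃ (b : Module.Basis (Fin d) ℝ (EuclideanSpace ℝ (Fin d))) (a : EuclideanSpace ℝ (Fin d))
      (φ : EuclideanSpace ℝ (Fin d) ≃ₜ (Fin d → ℝ)),
      (∀ x i, φ x i = b.repr (x - a) i) ∧ Ω = φ ⁻¹' Set.Icc 0 1 := by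
  obtain ⟨a, v, hv, rfl⟩ := hΩ
  set b := basisOfLinearIndependentOfCardEqFinrank' v hv (by simp) with hb
  have hbv : ⇑b = v := coe_basisOfLinearIndependentOfCardEqFinrank' ..
  refine ⟨b, a, (Homeomorph.addRight (-a)).trans b.equivFunL.toHomeomorph, fun x i => ?_, ?_⟩
  · simp [sub_eq_add_neg]
  · rw [← hbv, parallelepiped_basis_eq]
    ext x
    simp only [Set.image_add_left, Set.mem_preimage, Set.mem_ofPred_eq, Set.mem_Icc, Pi.le_def]
    simp [forall_and, add_comm]

lemma generatesTiling_of_isParallelepiped {Ω : Set (EuclideanSpace ℝ (Fin d))}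
    (hΩ : IsParallelepiped Ω) :
    IsCompact Ω ∧ Convex ℝ Ω ∧ (interior Ω).Nonempty ∧ GeneratesTiling Ω := by
  have hconv : Convex ℝ Ω := by
    obtain ⟨a, v, -, rfl⟩ := hΩ
    rw [parallelepiped_eq_convexHull]
    exact (convex_convexHull ℝ _).translate a
  obtain ⟨b, a, φ, hφ, rfl⟩ := exists_homeomorph_of_isParallelepiped hΩ
  have hint : interior (φ ⁻¹' Set.Icc 0 1) = φ ⁻¹' (Set.univ.pi fun _ => Set.Ioo 0 1) := by
    rw [← φ.preimage_interior, ← Set.pi_univ_Icc, interior_pi_set Set.finite_univ]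
    simp
  refine ⟨φ.isCompact_preimage.2 isCompact_Icc, hconv, ?_, ?_⟩
  · rw [hint]
    refine ⟨φ.symm fun _ => 1 / 2, ?_⟩
    simp only [Set.mem_preimage, Homeomorph.apply_symm_apply, Set.mem_pi]
    norm_num
  -- The tiling group is the lattice spanned by the edges. Integer parts of the coordinates select
  -- the covering copy.
  set u : (Fin d → ℤ) → EuclideanSpace ℝ (Fin d) := fun k => ∑ i, (k i : ℝ) • b i with hu
  have hub : ∀ k i, b.repr (u k) i = k i := fun k i => by
    rw [hu]
    exact b.repr_sum_self _ ▸ rfl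
  refine ⟨Set.range fun k => AffineIsometryEquiv.constVAdd ℝ _ (u k), ?_, ?_⟩
  · refine Set.eq_univ_of_forall fun x => ?_
    simp only [Set.mem_iUnion₂]
    refine ⟨_, ⟨fun i => ⌊b.repr (x - a) i⌋, rfl⟩,
      x - u fun i => ⌊b.repr (x - a) i⌋, ?_, by simp⟩
    rw [Set.mem_preimage, Set.mem_Icc, Pi.le_def, Pi.le_def, ← forall_and]
    intro i
    rw [hφ, sub_right_comm, map_sub, Finsupp.sub_apply, hub]
    exact ⟨Int.fract_nonneg _, (Int.fract_lt_one _).le⟩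
  · rintro _ ⟨k, rfl⟩ _ ⟨l, rfl⟩ hkl
    refine Set.disjoint_left.2 ?_
    rintro _ ⟨x, hx, rfl⟩ ⟨y, hy, hxy⟩
    refine hkl ?_
    simp only
    congr 1
    rw [hint] at hx hy
    congr 1
    ext i
    have hx' := hx i trivial
    have hy' := hy i trivial
    rw [hφ, map_sub, Finsupp.sub_apply] at hx' hy'
    simp only [AffineIsometryEquiv.coe_constVAdd, vadd_eq_add] at hxy
    have h1 := congrArg (fun z => b.repr z i) hxy
    simp only [map_add, Finsupp.add_apply, hub] at h1
    -- Two numbers in the open unit interval differ by less than one, so the integers `k i` and `l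
    -- i` coincide.
    have h2 : (k i : ℝ) < l i + 1 := by linarith [hx'.1, hx'.2, hy'.1, hy'.2]
    have h3 : (l i : ℝ) < k i + 1 := by linarith [hx'.1, hx'.2, hy'.1, hy'.2]
    have h2' : k i < l i + 1 := by exact_mod_cast h2
    have h3' : l i < k i + 1 := by exact_mod_cast h3
    omega

end Parallelepiped

end UEG

/-- The thermodynamic limit `e_UEG` exists, and it is a lower bound of `E(Ω) / |Ω|` for every
parallelepiped and every convex polyhedron `Ω` that tiles the space, if `|Ω|` is an integer. -/
theorem theorem2p7 (d : ℕ) (s : ℝ) (hs : 0 < s) (hsd : s < d) :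
    UEG.IsThermodynamicLimit d s (UEG.eUEG d s) ∧
      ∀ Ω : Set (EuclideanSpace ℝ (Fin d)),
        (UEG.IsParallelepiped Ω ∨ (UEG.IsConvexPolyhedron Ω ∧ UEG.GeneratesTiling Ω)) →
        (∃ N : ℕ, volume Ω = N) →
        UEG.setEnergy s Ω / volume.real Ω ≥ UEG.eUEG d s := by
  -- `eUEG` is an arbitrary choice among the limits, so the existence of one suffices; uniqueness
  -- plays no role.
  have hlim : UEG.IsThermodynamicLimit d s (UEG.eUEG d s) :=
    Classical.epsilon_spec ⟨_, UEG.isThermodynamicLimit_cubeLimit hs hsd⟩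
  refine ⟨hlim, fun Ω hΩ ⟨N, hN⟩ => ?_⟩
  obtain ⟨hcpt, hconv, hne, htile⟩ : IsCompact Ω ∧ Convex ℝ Ω ∧ (interior Ω).Nonempty ∧
      UEG.GeneratesTiling Ω := by
    rcases hΩ with hΩ | ⟨⟨⟨S, rfl⟩, hne⟩, htile⟩
    · exact UEG.generatesTiling_of_isParallelepiped hΩ
    · exact ⟨S.finite_toSet.isCompact_convexHull (𝕜 := ℝ), convex_convexHull ℝ _, hne, htile⟩
  exact UEG.le_setEnergy_div_of_generatesTiling hs hsd hlim hcpt.measurableSet hconv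
    hcpt.isBounded hne htile hN
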